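/- **Theorem.** Let $n>2$ and let $U$ be a non-empty convex open subset (for example all) of the space $\mathbb{R}^{n+2}$ with coordinates $(t,x,y_1,\dots,y_{n-1},u)$. Let $I\subseteq\mathbb{R}$ be the set of values of $t$ on $U$. Put $$E=(u_t+uu_x)_x+\sum_{i=1}^{n-1}u_{y_iy_i}.$$ A smooth vector field $X=\tau\partial_t+\xi\partial_x+\sum_{i=1}^{n-1}\xi_i\partial_{y_i}+\eta\,\partial_u$ on $U$ (with coefficients depending on all of $t,x,y,u$) is called a Lie point symmetry of $E=0$ if its second prolongation satisfies $\mathrm{pr}^{(2)}X(E)=0$ at every second-order jet over $U$ at which $E=0$. 1. $X$ is a Lie point symmetry of $E=0$ if and only if there are real constants $\tau_0,\tau_1,\tau_2,\sigma$, $c_{ij}=-c_{ji}$ $(1\le i,j\le n-1)$ and smooth functions $F_1,\dots,F_n$ on $I$ such that on $U$ $$\tau=\tau_2t^2+\tau_1t+\tau_0,$$ $$\xi=\frac{\tau_2}{n+7}\Bigl[2(5-n)xt-3\sum_{i=1}^{n-1}y_i^2\Bigr]+(2\sigma-\tau_1)x-\frac12\sum_{i=1}^{n-1}F_i'(t)y_i+F_n(t),$$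 $$\xi_i=\Bigl(\frac{12\tau_2t}{n+7}+\sigma\Bigr)y_i+\sum_{j=1}^{n-1}c_{ij}y_j+F_i(t),\qquad 1\le i\le n-1,$$ $$\eta=\frac{1}{n+7}\bigl[-4(n+1)\tau_2t+2(n+7)(\sigma-\tau_1)\bigr]u+\frac{2(5-n)}{n+7}\tau_2x-\frac12\sum_{i=1}^{n-1}F_i''(t)y_i+F_n'(t).$$ 2. The constants $\tau_0,\tau_1,\tau_2,\sigma,c_{ij}$ and the functions $F_1,\dots,F_n$ on $I$ are uniquely determined by $X$. 3. The set of Lie point symmetries is the real linear span of the restrictions to $U$ of the vector fields $$T=\partial_t,\quad \tilde D=t\partial_t-x\partial_x-2u\partial_u,\quad D_0=2x\partial_x+\sum_i y_i\partial_{y_i}+2u\partial_u,$$ $$C=t^2\partial_t+\frac{1}{n+7}\Bigl[2(5-n)xt-3\sum_i y_i^2\Bigr]\partial_x+\frac{12t}{n+7}\sum_i y_i\partial_{y_i}+\frac{2}{n+7}\bigl[(5-n)x-2(n+1)tu\bigr]\partial_u,$$ $$R_{ij}=y_i\partial_{y_j}-y_j\partial_{y_i}\quad(1\le i<j\le n-1),$$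 $$X(F)=F(t)\partial_x+F'(t)\partial_u,\qquad Y_i(F)=F(t)\partial_{y_i}-\tfrac12F'(t)y_i\partial_x-\tfrac12F''(t)y_i\partial_u\quad(1\le i\le n-1),$$ where $F$ runs over the smooth functions on $I$. 4. The set of Lie point symmetries is closed under the Lie bracket of vector fields. -/

import Mathlib

open scoped ContDiff

namespace DKP

/-- Index set of the independent variables `(t, x, y_1, …, y_{n-1})`. -/
abbrev Var (n : ℕ) : Type := Fin 2 ⊕ Fin (n - 1)

/-- The index of `t`. -/
abbrev tv (n : ℕ) : Var n := Sum.inl 0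

/-- The index of `x`. -/
abbrev xv (n : ℕ) : Var n := Sum.inl 1

/-- The index of the transverse variable `y_i`. -/
abbrev yv {n : ℕ} (i : Fin (n - 1)) : Var n := Sum.inr i

/-- The space of independent and dependent variables: `b.1` is the point `(t, x, y)` and
`b.2` is the value of `u`. -/
abbrev J0 (n : ℕ) : Type := (Var n → ℝ) × ℝ

/-- First jets: `q.1` is the underlying point of `J0` and `q.2 i` is the derivative `u_i`. -/
abbrev J1 (n : ℕ) : Type := J0 n × (Var n → ℝ)

/-- Second jets: `s.1` is the underlying first jet and `s.2 i j` is the derivative `u_{ij}`.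
The genuine second jets are those whose `s.2` is symmetric in `i` and `j`. -/
abbrev J2 (n : ℕ) : Type := J1 n × (Var n → Var n → ℝ)

/-- The total derivative `D_i f = ∂_i f + u_i ∂_u f` of a function on `J0`. -/
noncomputable def totalDeriv0 {n : ℕ} (i : Var n) (f : J0 n → ℝ) (q : J1 n) : ℝ :=
  fderiv ℝ f q.1 (Pi.single i 1, q.2 i)

/-- The total derivative `D_j g = ∂_j g + u_j ∂_u g + ∑_k u_{kj} ∂_{u_k} g` of a function on
`J1`. -/
noncomputable def totalDeriv1 {n : ℕ} (j : Var n) (g : J1 n → ℝ) (s : J2 n) : ℝ :=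
  fderiv ℝ g s.1 ((Pi.single j 1, s.1.2 j), fun k => s.2 k j)

/-- The coefficient `η^i = D_i η - ∑_k u_k D_i ξ^k` of `∂_{u_i}` in the prolongation of the vector
field `X = ∑_k ξ^k ∂_k + η ∂_u`, where `ξ^k b = (X b).1 k` and `η b = (X b).2`. -/
noncomputable def prolongCoeff1 {n : ℕ} (X : J0 n → J0 n) (i : Var n) (q : J1 n) : ℝ :=
  totalDeriv0 i (fun b => (X b).2) q
    - ∑ k : Var n, q.2 k * totalDeriv0 i (fun b => (X b).1 k) q

/-- The coefficient `η^{ij} = D_j η^i - ∑_k u_{ik} D_j ξ^k` of `∂_{u_{ij}}` in the prolongation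
of `X`. -/
noncomputable def prolongCoeff2 {n : ℕ} (X : J0 n → J0 n) (i j : Var n) (s : J2 n) : ℝ :=
  totalDeriv1 j (prolongCoeff1 X i) s
    - ∑ k : Var n, s.2 i k * totalDeriv0 j (fun b => (X b).1 k) s.1

/-- The second prolongation of the vector field `X`, a vector field on the second jets. -/
noncomputable def prolong2 {n : ℕ} (X : J0 n → J0 n) (s : J2 n) : J2 n :=
  ((X s.1.1, fun i => prolongCoeff1 X i s.1), fun i j => prolongCoeff2 X i j s)

/-- The left-hand side of the equation as a function of second jets:
`(u_t + u u_x)_x + Δ_⊥ u = u_{tx} + u_x ^ 2 + u u_{xx} + ∑_i u_{y_i y_i}`. -/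
def E (n : ℕ) (s : J2 n) : ℝ :=
  s.2 (tv n) (xv n) + s.1.2 (xv n) ^ 2 + s.1.1.2 * s.2 (xv n) (xv n)
    + ∑ i : Fin (n - 1), s.2 (yv i) (yv i)

/-- `X` is an infinitesimal Lie point symmetry on `U`: it is smooth on `U`, and its second
prolongation annihilates `E` at every second jet over `U` at which `E = 0`. Only the restriction
of `X` to `U` matters when `U` is open. -/
def IsLieSymmetry (n : ℕ) (U : Set (J0 n)) (X : J0 n → J0 n) : Prop :=
  ContDiffOn ℝ ∞ X U ∧
    ∀ s : J2 n, s.1.1 ∈ U → (∀ i j, s.2 i j = s.2 j i) → E n s = 0 →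
      fderiv ℝ (E n) s (prolong2 X s) = 0

/-- The set of times occurring in `U`. -/
def times {n : ℕ} (U : Set (J0 n)) : Set ℝ := (fun b : J0 n => b.1 (tv n)) '' U

/-- The vector with components `τ`, `ξ`, `ξ_i`, `η` along `∂_t`, `∂_x`, `∂_{y_i}`, `∂_u`. -/
def vec {n : ℕ} (τ ξ : ℝ) (ξy : Fin (n - 1) → ℝ) (η : ℝ) : J0 n :=
  (Sum.elim ![τ, ξ] ξy, η)

/-- The general vector field of the family, with constants `τ0 τ1 τ2 σ`, matrix `c`, and functions
of time `F i` (`F_1, …, F_{n-1}`) and `Fn` (`F_n`). -/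
noncomputable def generalField (n : ℕ) (τ0 τ1 τ2 σ : ℝ)
    (c : Matrix (Fin (n - 1)) (Fin (n - 1)) ℝ) (F : Fin (n - 1) → ℝ → ℝ) (Fn : ℝ → ℝ)
    (b : J0 n) : J0 n :=
  let t := b.1 (tv n)
  let x := b.1 (xv n)
  let y : Fin (n - 1) → ℝ := fun i => b.1 (yv i)
  let u := b.2
  vec (τ2 * t ^ 2 + τ1 * t + τ0)
    (τ2 / (n + 7) * (2 * (5 - n) * x * t - 3 * ∑ i, y i ^ 2) + (2 * σ - τ1) * x
      - 1 / 2 * ∑ i, deriv (F i) t * y i + Fn t)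
    (fun i => (12 * τ2 * t / (n + 7) + σ) * y i + ∑ j, c i j * y j + F i t)
    (1 / (n + 7) * (-4 * (n + 1) * τ2 * t + 2 * (n + 7) * (σ - τ1)) * u
      + 2 * (5 - n) / (n + 7) * τ2 * x
      - 1 / 2 * ∑ i, deriv (deriv (F i)) t * y i + deriv Fn t)

/-- `T = ∂_t`. -/
def fieldT (n : ℕ) (_ : J0 n) : J0 n := vec 1 0 0 0

/-- `D̃ = t ∂_t - x ∂_x - 2 u ∂_u`. -/
def fieldDtilde (n : ℕ) (b : J0 n) : J0 n :=
  vec (b.1 (tv n)) (-b.1 (xv n)) 0 (-2 * b.2)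

/-- The projective field `C = t² ∂_t + (n+7)⁻¹ (2 (5-n) x t - 3 |y|²) ∂_x + 12 t (n+7)⁻¹ y·∂_y
+ 2 (n+7)⁻¹ ((5-n) x - 2 (n+1) t u) ∂_u`. -/
noncomputable def fieldC (n : ℕ) (b : J0 n) : J0 n :=
  let t := b.1 (tv n)
  let x := b.1 (xv n)
  let y : Fin (n - 1) → ℝ := fun i => b.1 (yv i)
  let u := b.2
  vec (t ^ 2)
    (1 / (n + 7) * (2 * (5 - n) * x * t - 3 * ∑ i, y i ^ 2))
    (fun i => 12 * t / (n + 7) * y i)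
    (2 / (n + 7) * ((5 - n) * x - 2 * (n + 1) * t * u))

/-- `D_0 = 2 x ∂_x + y·∂_y + 2 u ∂_u`. -/
def fieldD0 (n : ℕ) (b : J0 n) : J0 n :=
  vec 0 (2 * b.1 (xv n)) (fun i => b.1 (yv i)) (2 * b.2)

/-- `R_{ij} = y_i ∂_{y_j} - y_j ∂_{y_i}`. -/
def fieldR (n : ℕ) (i j : Fin (n - 1)) (b : J0 n) : J0 n :=
  vec 0 0 (Pi.single j (b.1 (yv i)) - Pi.single i (b.1 (yv j))) 0

/-- `X(f) = f(t) ∂_x + f'(t) ∂_u`. -/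
noncomputable def fieldX (n : ℕ) (f : ℝ → ℝ) (b : J0 n) : J0 n :=
  vec 0 (f (b.1 (tv n))) 0 (deriv f (b.1 (tv n)))

/-- `Y_i(f) = f(t) ∂_{y_i} - (1/2) f'(t) y_i ∂_x - (1/2) f''(t) y_i ∂_u`. -/
noncomputable def fieldY (n : ℕ) (i : Fin (n - 1)) (f : ℝ → ℝ) (b : J0 n) : J0 n :=
  vec 0 (-(1 / 2) * deriv f (b.1 (tv n)) * b.1 (yv i)) (Pi.single i (f (b.1 (tv n))))
    (-(1 / 2) * deriv (deriv f) (b.1 (tv n)) * b.1 (yv i))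

/-- The fields `T`, `D̃`, `C`, `D_0`, `R_{ij}` for `i < j`, and `X(f)`, `Y_i(f)` for all functions
`f` that are smooth on the set `I` of times. -/
def generators (n : ℕ) (I : Set ℝ) : Set (J0 n → J0 n) :=
  {fieldT n, fieldDtilde n, fieldC n, fieldD0 n}
    ∪ {Z | ∃ i j : Fin (n - 1), i < j ∧ Z = fieldR n i j}
    ∪ {Z | ∃ f : ℝ → ℝ, ContDiffOn ℝ ∞ f I ∧ Z = fieldX n f}
    ∪ {Z | ∃ (i : Fin (n - 1)) (f : ℝ → ℝ), ContDiffOn ℝ ∞ f I ∧ Z = fieldY n i f}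

end DKP

/-!
The second prolongation of a vector field `X = τ ∂_t + ξ ∂_x + ∑ ξ_i ∂_{y_i} + η ∂_u`, applied to
`E`, is affine in the second derivatives of `u` (`fderiv_E_prolong2`). On the hypersurface `E = 0`
the entry `u_{tx}` is determined and all other second derivatives are free, so every coefficient
has to vanish separately. Evaluating at matrices of second derivatives of the form `v ⊗ w + w ⊗ v`,
corrected in the entry `u_{tx}` (`IsLieSymmetry.onShell`), gives the first-order determining
equations. They hold for all values of the first derivatives of `u`, which makes `τ`, `ξ`, `ξ_i`
independent of `u` (`IsLieSymmetry.firstOrder`).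

The first-order equations are solved explicitly (`FirstOrder.exists_ansatz`): `τ` and
`μ = ξ_x + τ_t` are functions of `t`, the `ξ_i` form a Killing field of the transverse space up to a
homothety with factor `μ / 2`, its rotational part is constant in time, and `ξ`, `η` follow by
integration. The convexity of `U` enters here: it makes functions without derivatives in the
directions `x`, `y`, `u` functions of `t` (`exists_eq_time`).

On such a field the prolongation acts on `E` as `-2 τ' E` plus terms whose vanishing amounts to
`(n + 7) μ' = 12 τ''` and `(5 - n) μ'' = 4 τ'''` (`fderiv_E_prolong2_ansatz`). Together they give
`(n - 2) τ''' = 0`, so that for `n > 2` the function `τ` is a quadratic polynomial and `μ` is affine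
(`exists_of_ode`); this is the stated family. The solutions of the first-order equations are closed
under the Lie bracket with explicit new coefficients (`lieBracket_ansatz`), and the quadratic `τ`
with their affine `μ` are preserved. Uniqueness of the parameters and the expansion in the generators
are read off from the explicit form.
-/

namespace DKP

/-! ### Directional derivatives on an open set -/

/-- The derivative of `f` in the constant direction `v`, as a function of the point. -/
noncomputable def pd {n : ℕ} (v : J0 n) (f : J0 n → ℝ) (b : J0 n) : ℝ := fderiv ℝ f b v

/-- The coordinate direction of the independent variable `k`. -/
def dirI {n : ℕ} (k : Var n) : J0 n := (Pi.single k 1, 0)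

/-- The coordinate direction of the dependent variable. -/
def dirU (n : ℕ) : J0 n := (0, 1)

/-- The direction `∂_k + u_k ∂_u` at a first jet with derivatives `q`; differentiating along it is
the total derivative `D_k` on functions on `J0`. -/
def dirD {n : ℕ} (q : Var n → ℝ) (k : Var n) : J0 n := (Pi.single k 1, q k)

theorem dirD_eq {n : ℕ} (q : Var n → ℝ) (k : Var n) : dirD q k = dirI k + q k • dirU n := by
  simp [dirD, dirI, dirU]

section Calculus

variable {n : ℕ} {U : Set (J0 n)} {f g : J0 n → ℝ} {b : J0 n}

theorem pd_dirD (q : Var n → ℝ) (k : Var n) (f : J0 n → ℝ) (b : J0 n) :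
    pd (dirD q k) f b = pd (dirI k) f b + q k * pd (dirU n) f b := by
  simp [pd, dirD_eq]

theorem pd_congr (hU : IsOpen U) (h : Set.EqOn f g U) (v : J0 n) :
    Set.EqOn (pd v f) (pd v g) U := by
  intro b hb
  have := (h.eventuallyEq_of_mem (hU.mem_nhds hb)).fderiv_eq (𝕜 := ℝ)
  simp [pd, this]

theorem differentiableAt_of_smooth (hU : IsOpen U) (hf : ContDiffOn ℝ ∞ f U) (hb : b ∈ U) :
    DifferentiableAt ℝ f b :=
  (hf.contDiffAt (hU.mem_nhds hb)).differentiableAt (by simp)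

theorem contDiffOn_pd (hU : IsOpen U) (hf : ContDiffOn ℝ ∞ f U) (v : J0 n) :
    ContDiffOn ℝ ∞ (pd v f) U :=
  ((contDiffOn_infty_iff_fderiv_of_isOpen hU).1 hf).2.clm_apply contDiffOn_const

theorem differentiableAt_fderiv_of_smooth (hU : IsOpen U) (hf : ContDiffOn ℝ ∞ f U)
    (hb : b ∈ U) : DifferentiableAt ℝ (fderiv ℝ f) b :=
  ((((contDiffOn_infty_iff_fderiv_of_isOpen hU).1 hf).2).contDiffAt
    (hU.mem_nhds hb)).differentiableAt (by simp)

theorem pd_pd_eq (hU : IsOpen U) (hf : ContDiffOn ℝ ∞ f U) (hb : b ∈ U) (v w : J0 n) :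
    pd v (pd w f) b = fderiv ℝ (fderiv ℝ f) b v w := by
  have h := ((differentiableAt_fderiv_of_smooth hU hf hb).hasFDerivAt.clm_apply
    (hasFDerivAt_const w b)).fderiv
  change fderiv ℝ (fun y => fderiv ℝ f y w) b v = _
  rw [h]
  simp

theorem pd_comm (hU : IsOpen U) (hf : ContDiffOn ℝ ∞ f U) (hb : b ∈ U) (v w : J0 n) :
    pd v (pd w f) b = pd w (pd v f) b := by
  have hs : IsSymmSndFDerivAt ℝ f b :=
    (hf.contDiffAt (hU.mem_nhds hb)).isSymmSndFDerivAt
      (by simpa using WithTop.coe_le_coe.2 (le_top : (2 : ℕ∞) ≤ ⊤))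
  rw [pd_pd_eq hU hf hb, pd_pd_eq hU hf hb, hs.eq]

end Calculus

/-! ### The second prolongation in terms of partial derivatives -/

/-- The derivative of `D_i f` along the directions that occur in `totalDeriv1`: differentiating along
`∂_j + u_j ∂_u` with the first derivatives of `u` held fixed, plus the contribution `r_i f_u` of the
change `r` of the first derivatives. -/
theorem hasFDerivAt_totalDeriv0 {n : ℕ} {U : Set (J0 n)} (hU : IsOpen U) {f : J0 n → ℝ}
    (hf : ContDiffOn ℝ ∞ f U) (i : Var n) (q : J1 n) (hq : q.1 ∈ U) :
    ∃ L : J1 n →L[ℝ] ℝ, HasFDerivAt (totalDeriv0 i f) L q ∧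
      ∀ (j : Var n) (r : Var n → ℝ), L (dirD q.2 j, r) =
        pd (dirD q.2 j) (pd (dirD q.2 i) f) q.1 + r i * pd (dirU n) f q.1 := by
  have h1 : HasFDerivAt (fun q : J1 n => fderiv ℝ f q.1)
      ((fderiv ℝ (fderiv ℝ f) q.1).comp (ContinuousLinearMap.fst ℝ (J0 n) (Var n → ℝ))) q :=
    (differentiableAt_fderiv_of_smooth hU hf hq).hasFDerivAt.comp q (hasFDerivAt_fst (𝕜 := ℝ) (p := q))
  have h2 : HasFDerivAt (fun q : J1 n => ((Pi.single i 1, q.2 i) : J0 n))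
      ((0 : J1 n →L[ℝ] (Var n → ℝ)).prod
        ((ContinuousLinearMap.proj i).comp
          (ContinuousLinearMap.snd ℝ (J0 n) (Var n → ℝ)))) q :=
    (hasFDerivAt_const _ _).prodMk
      (((ContinuousLinearMap.proj (R := ℝ) (φ := fun _ : Var n => ℝ) i).comp
          (ContinuousLinearMap.snd ℝ (J0 n) (Var n → ℝ))).hasFDerivAt)
  refine ⟨_, h1.clm_apply h2, fun j r => ?_⟩
  rw [pd_pd_eq hU hf hq]
  have e : ((0, r i) : J0 n) = r i • dirU n := by simp [dirU]
  simp [e, pd]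
  simp [dirD]; ring

/-- The coefficient `η^{ij}` is affine in the second derivatives of `u`. -/
theorem prolongCoeff2_eq {n : ℕ} {U : Set (J0 n)} (hU : IsOpen U) {X : J0 n → J0 n}
    (hX : ContDiffOn ℝ ∞ X U) (i j : Var n) (s : J2 n) (hs : s.1.1 ∈ U) :
    prolongCoeff2 X i j s =
      (pd (dirD s.1.2 j) (pd (dirD s.1.2 i) fun b => (X b).2) s.1.1
        - ∑ k, s.1.2 k * pd (dirD s.1.2 j) (pd (dirD s.1.2 i) fun b => (X b).1 k) s.1.1)
      + s.2 i j * (pd (dirU n) (fun b => (X b).2) s.1.1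
        - ∑ k, s.1.2 k * pd (dirU n) (fun b => (X b).1 k) s.1.1)
      - ∑ k, s.2 k j * pd (dirD s.1.2 i) (fun b => (X b).1 k) s.1.1
      - ∑ k, s.2 i k * pd (dirD s.1.2 j) (fun b => (X b).1 k) s.1.1 := by
  have hη : ContDiffOn ℝ ∞ (fun b => (X b).2) U := contDiff_snd.comp_contDiffOn hX
  have hξ : ∀ k, ContDiffOn ℝ ∞ (fun b => (X b).1 k) U := fun k =>
    ((contDiff_apply ℝ ℝ k).comp contDiff_fst).comp_contDiffOn hX
  obtain ⟨L, hL, hL'⟩ := hasFDerivAt_totalDeriv0 hU hη i s.1 hs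
  choose M hM hM' using fun k => hasFDerivAt_totalDeriv0 hU (hξ k) i s.1 hs
  have hq : ∀ k, HasFDerivAt (fun q : J1 n => q.2 k)
      ((ContinuousLinearMap.proj (R := ℝ) (φ := fun _ : Var n => ℝ) k).comp
          (ContinuousLinearMap.snd ℝ (J0 n) (Var n → ℝ))) s.1 := fun k =>
    ((ContinuousLinearMap.proj (R := ℝ) (φ := fun _ : Var n => ℝ) k).comp
          (ContinuousLinearMap.snd ℝ (J0 n) (Var n → ℝ))).hasFDerivAt
  have h := hL.sub (HasFDerivAt.fun_sum (u := Finset.univ) fun k _ => (hq k).mul (hM k))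
  have h' : fderiv ℝ (prolongCoeff1 X i) s.1 = _ := h.fderiv
  have e : ((Pi.single j 1, s.1.2 j) : J0 n) = dirD s.1.2 j := rfl
  have t0 : ∀ (a : Var n) (f : J0 n → ℝ), totalDeriv0 a f s.1 = pd (dirD s.1.2 a) f s.1.1 :=
    fun _ _ => rfl
  rw [prolongCoeff2, totalDeriv1, h', e]
  simp only [t0, _root_.sub_apply, _root_.sum_apply,
    _root_.add_apply, _root_.smul_apply, hL', hM', smul_eq_mul,
    ContinuousLinearMap.comp_apply, ContinuousLinearMap.coe_snd', ContinuousLinearMap.proj_apply,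
    mul_add, Finset.sum_add_distrib, mul_sub, Finset.mul_sum]
  have e1 : ∀ k, pd (dirD s.1.2 i) (fun b => (X b).1 k) s.1.1 * s.2 k j
      = s.2 k j * pd (dirD s.1.2 i) (fun b => (X b).1 k) s.1.1 := fun k => mul_comm _ _
  have e2 : ∀ k, s.1.2 k * (s.2 i j * pd (dirU n) (fun b => (X b).1 k) s.1.1)
      = s.2 i j * (s.1.2 k * pd (dirU n) (fun b => (X b).1 k) s.1.1) := fun k => by ring
  simp only [e1, e2]
  ring

theorem fderiv_E (n : ℕ) (s d : J2 n) :
    fderiv ℝ (E n) s d = d.2 (tv n) (xv n) + 2 * s.1.2 (xv n) * d.1.2 (xv n)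
      + d.1.1.2 * s.2 (xv n) (xv n) + s.1.1.2 * d.2 (xv n) (xv n)
      + ∑ i : Fin (n - 1), d.2 (yv i) (yv i) := by
  let c2 : Var n → Var n → J2 n →L[ℝ] ℝ := fun i j =>
    (ContinuousLinearMap.proj (R := ℝ) (φ := fun _ : Var n => ℝ) j).comp
      ((ContinuousLinearMap.proj (R := ℝ) (φ := fun _ : Var n => (Var n → ℝ)) i).comp
        (ContinuousLinearMap.snd ℝ (J1 n) (Var n → Var n → ℝ)))
  let c1 : J2 n →L[ℝ] ℝ := (ContinuousLinearMap.proj (R := ℝ) (φ := fun _ : Var n => ℝ) (xv n)).comp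
    ((ContinuousLinearMap.snd ℝ (J0 n) (Var n → ℝ)).comp
      (ContinuousLinearMap.fst ℝ (J1 n) (Var n → Var n → ℝ)))
  let c0 : J2 n →L[ℝ] ℝ := (ContinuousLinearMap.snd ℝ (Var n → ℝ) ℝ).comp
    ((ContinuousLinearMap.fst ℝ (J0 n) (Var n → ℝ)).comp
      (ContinuousLinearMap.fst ℝ (J1 n) (Var n → Var n → ℝ)))
  have h2 : ∀ i j, HasFDerivAt (fun s : J2 n => s.2 i j) (c2 i j) s := fun i j =>
    (c2 i j).hasFDerivAt
  have h1 : HasFDerivAt (fun s : J2 n => s.1.2 (xv n)) c1 s := c1.hasFDerivAt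
  have h0 : HasFDerivAt (fun s : J2 n => s.1.1.2) c0 s := c0.hasFDerivAt
  have h : HasFDerivAt (E n) _ s := (((h2 (tv n) (xv n)).add (h1.pow 2)).add
    (h0.mul (h2 (xv n) (xv n)))).add
    (HasFDerivAt.fun_sum (u := Finset.univ) fun i _ => h2 (yv i) (yv i))
  rw [h.fderiv]
  simp [c2, c1, c0]
  ring

/-- The component of `X` along the independent variable `k`. -/
abbrev comp {n : ℕ} (X : J0 n → J0 n) (k : Var n) (b : J0 n) : ℝ := (X b).1 k

/-- The component of `X` along the dependent variable. -/
abbrev compU {n : ℕ} (X : J0 n → J0 n) (b : J0 n) : ℝ := (X b).2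

/-- The total derivative `D_i ξ^k` at the first jet `(b, q)`. -/
noncomputable def totComp {n : ℕ} (X : J0 n → J0 n) (b : J0 n) (q : Var n → ℝ) (i k : Var n) : ℝ :=
  pd (dirD q i) (comp X k) b

/-- The derivative along `v` of the characteristic `η - ∑ u_k ξ^k`, with `u_k = q_k` held fixed. -/
noncomputable def char1 {n : ℕ} (X : J0 n → J0 n) (b : J0 n) (q : Var n → ℝ) (v : J0 n) : ℝ :=
  pd v (compU X) b - ∑ k, q k * pd v (comp X k) b

/-- The second derivative along `v` and `w` of the characteristic `η - ∑ u_k ξ^k`, with `u_k = q_k`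
held fixed. -/
noncomputable def char2 {n : ℕ} (X : J0 n → J0 n) (b : J0 n) (q : Var n → ℝ) (v w : J0 n) : ℝ :=
  pd v (pd w (compU X)) b - ∑ k, q k * pd v (pd w (comp X k)) b

/-- The part of `pr⁽²⁾X(E)` that does not involve second derivatives of `u`. -/
noncomputable def lowerPart {n : ℕ} (X : J0 n → J0 n) (b : J0 n) (q : Var n → ℝ) : ℝ :=
  char2 X b q (dirD q (xv n)) (dirD q (tv n)) + b.2 * char2 X b q (dirD q (xv n)) (dirD q (xv n))
    + ∑ i, char2 X b q (dirD q (yv i)) (dirD q (yv i))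
    + 2 * q (xv n) * char1 X b q (dirD q (xv n))

section

variable {n : ℕ} {U : Set (J0 n)} {X : J0 n → J0 n}

theorem contDiffOn_comp (hX : ContDiffOn ℝ ∞ X U) (k : Var n) : ContDiffOn ℝ ∞ (comp X k) U :=
  ((contDiff_apply ℝ ℝ k).comp contDiff_fst).comp_contDiffOn hX

/-- The prolonged field applied to `E`, as a polynomial in the second derivatives of `u`. -/
theorem fderiv_E_prolong2 (hU : IsOpen U) (hX : ContDiffOn ℝ ∞ X U) (s : J2 n)
    (hs : s.1.1 ∈ U) :
    fderiv ℝ (E n) s (prolong2 X s) = lowerPart X s.1.1 s.1.2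
      + compU X s.1.1 * s.2 (xv n) (xv n)
      + char1 X s.1.1 s.1.2 (dirU n) * (s.2 (tv n) (xv n) + s.1.1.2 * s.2 (xv n) (xv n)
          + ∑ i, s.2 (yv i) (yv i))
      - ∑ k, (s.2 k (xv n) * totComp X s.1.1 s.1.2 (tv n) k
          + s.2 (tv n) k * totComp X s.1.1 s.1.2 (xv n) k)
      - s.1.1.2 * ∑ k, (s.2 k (xv n) + s.2 (xv n) k) * totComp X s.1.1 s.1.2 (xv n) k
      - ∑ i, ∑ k, (s.2 k (yv i) + s.2 (yv i) k) * totComp X s.1.1 s.1.2 (yv i) k := by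
  have e1 : ∀ i, prolongCoeff1 X i s.1 = char1 X s.1.1 s.1.2 (dirD s.1.2 i) := fun _ => rfl
  rw [fderiv_E]
  simp only [prolong2, prolongCoeff2_eq hU hX _ _ s hs, e1]
  simp only [lowerPart, char1, char2, totComp, compU, Finset.sum_add_distrib,
    Finset.sum_sub_distrib, add_mul, ← Finset.sum_mul]
  ring

/-- The value of the prolonged field on `E` at an on-shell jet whose matrix of second derivatives
is the symmetrised product `v ⊗ w + w ⊗ v`, corrected in the entry `u_{tx}`. -/
theorem IsLieSymmetry.onShell (hU : IsOpen U) (hX : IsLieSymmetry n U X) {b : J0 n} (hb : b ∈ U)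
    (q v w : Var n → ℝ) :
    lowerPart X b q - char1 X b q (dirU n) * q (xv n) ^ 2
      + 2 * compU X b * v (xv n) * w (xv n)
      + (q (xv n) ^ 2 + v (tv n) * w (xv n) + w (tv n) * v (xv n)
          + 2 * b.2 * v (xv n) * w (xv n) + 2 * ∑ i, v (yv i) * w (yv i))
        * (totComp X b q (xv n) (xv n) + totComp X b q (tv n) (tv n)
          + 2 * b.2 * totComp X b q (xv n) (tv n))
      - (w (xv n) * ∑ k, v k * totComp X b q (tv n) k
        + v (xv n) * ∑ k, w k * totComp X b q (tv n) k
        + v (tv n) * ∑ k, w k * totComp X b q (xv n) k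
        + w (tv n) * ∑ k, v k * totComp X b q (xv n) k)
      - 2 * b.2 * (w (xv n) * ∑ k, v k * totComp X b q (xv n) k
        + v (xv n) * ∑ k, w k * totComp X b q (xv n) k)
      - 2 * ∑ i, (w (yv i) * ∑ k, v k * totComp X b q (yv i) k
        + v (yv i) * ∑ k, w k * totComp X b q (yv i) k) = 0 := by
  -- the entry `u_{tx}` that puts the jet on the hypersurface `E = 0`
  set α : ℝ := -(q (xv n) ^ 2 + v (tv n) * w (xv n) + w (tv n) * v (xv n)
          + 2 * b.2 * v (xv n) * w (xv n) + 2 * ∑ i, v (yv i) * w (yv i)) with hα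
  have hy : ∑ i, (v (yv i) * w (yv i) + w (yv i) * v (yv i)) = 2 * ∑ i, v (yv i) * w (yv i) := by
    rw [Finset.mul_sum]; exact Finset.sum_congr rfl fun i _ => by ring
  let ex : Var n → ℝ := Pi.single (xv n) 1
  let et : Var n → ℝ := Pi.single (tv n) 1
  have hxx : ex (xv n) = 1 := by simp [ex]
  have hxt : ex (tv n) = 0 := by simp [ex]
  have htx : et (xv n) = 0 := by simp [et]
  have htt : et (tv n) = 1 := by simp [et]
  have hxy : ∀ i, ex (yv i) = 0 := fun i => by simp [ex]
  have hty : ∀ i, et (yv i) = 0 := fun i => by simp [et]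
  have sx : ∀ g : Var n → ℝ, ∑ k, ex k * g k = g (xv n) := fun g => by
    simp [ex, Pi.single_apply, -Fintype.sum_sum_type]
  have st : ∀ g : Var n → ℝ, ∑ k, et k * g k = g (tv n) := fun g => by
    simp [et, Pi.single_apply, -Fintype.sum_sum_type]
  let S : Var n → Var n → ℝ := fun i j =>
    α * (et i * ex j + ex i * et j) + (v i * w j + w i * v j)
  have hS : ∀ i j, S i j = S j i := fun i j => by simp only [S]; ring
  have hSl : ∀ (j : Var n) (g : Var n → ℝ), ∑ k, S k j * g k
      = α * (ex j * g (tv n) + et j * g (xv n)) + (w j * ∑ k, v k * g k + v j * ∑ k, w k * g k) := by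
    intro j g
    rw [← sx g, ← st g]
    simp only [Finset.mul_sum, ← Finset.sum_add_distrib]
    exact Finset.sum_congr rfl fun k _ => by simp only [S]; ring
  have key := hX.2 ((b, q), S) hb hS (by
    simp only [E, S, hxx, hxt, htx, htt, hxy, hty, mul_zero, add_zero, zero_add, mul_one, hy]
    rw [hα]; ring)
  rw [fderiv_E_prolong2 hU hX.1 ((b, q), S) hb] at key
  have e1 : ∀ g h : Var n → ℝ, ∑ k, (S k (xv n) * g k + S (tv n) k * h k)
      = ∑ k, S k (xv n) * g k + ∑ k, S k (tv n) * h k := fun g h => by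
    rw [← Finset.sum_add_distrib]
    exact Finset.sum_congr rfl fun k _ => by rw [hS (tv n) k]
  have e2 : ∀ (j : Var n) (g : Var n → ℝ), ∑ k, (S k j + S j k) * g k = 2 * ∑ k, S k j * g k :=
    fun j g => by
      rw [Finset.mul_sum]
      exact Finset.sum_congr rfl fun k _ => by rw [hS j k]; ring
  simp only [e1, e2, hSl] at key
  simp only [S, hxx, hxt, htx, htt, hxy, hty, mul_zero, zero_mul, add_zero, zero_add, mul_one,
    hy, ← Finset.mul_sum] at key
  rw [hα] at key
  linear_combination key

end

/-! ### Coefficients of the second derivatives of `u` -/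

section

variable {n : ℕ} {U : Set (J0 n)} {X : J0 n → J0 n} {b : J0 n}

theorem sum_single_mul {ι : Type*} [Fintype ι] [DecidableEq ι] (a : ι) (g : ι → ℝ) :
    ∑ k, (Pi.single a 1 : ι → ℝ) k * g k = g a := by
  simp [Pi.single_apply]

/-- The part without free second derivatives, at the jet whose only second derivative is
`u_{tx} = -u_x²`. -/
theorem IsLieSymmetry.base (hU : IsOpen U) (hX : IsLieSymmetry n U X) (hb : b ∈ U)
    (q : Var n → ℝ) :
    lowerPart X b q - char1 X b q (dirU n) * q (xv n) ^ 2
      + q (xv n) ^ 2 * (totComp X b q (xv n) (xv n) + totComp X b q (tv n) (tv n)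
          + 2 * b.2 * totComp X b q (xv n) (tv n)) = 0 := by
  have h := hX.onShell hU hb q 0 0
  simp only [Pi.zero_apply, zero_mul, mul_zero, Finset.sum_const_zero, add_zero, sub_zero] at h
  linear_combination h

/-- The coefficient of `u_{tt}`: the total derivative `D_x τ` vanishes. -/
theorem IsLieSymmetry.totComp_xt (hU : IsOpen U) (hX : IsLieSymmetry n U X) (hb : b ∈ U)
    (q : Var n → ℝ) : totComp X b q (xv n) (tv n) = 0 := by
  have h := hX.onShell hU hb q (Pi.single (tv n) 1) (Pi.single (tv n) 1)
  simp only [sum_single_mul] at h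
  simp at h
  linear_combination (-1/2) * h + 1/2 * hX.base hU hb q

/-- The coefficient of `u_{xx}`, which determines `η`. -/
theorem IsLieSymmetry.totComp_xx (hU : IsOpen U) (hX : IsLieSymmetry n U X) (hb : b ∈ U)
    (q : Var n → ℝ) : compU X b = totComp X b q (tv n) (xv n)
      + b.2 * (totComp X b q (xv n) (xv n) - totComp X b q (tv n) (tv n)) := by
  have h := hX.onShell hU hb q (Pi.single (xv n) 1) (Pi.single (xv n) 1)
  simp only [sum_single_mul, hX.totComp_xt hU hb] at h
  simp at h
  have h0 := hX.base hU hb q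
  rw [hX.totComp_xt hU hb] at h0
  linear_combination (1/2) * h - 1/2 * h0

/-- The coefficient of `u_{t y_i}`. -/
theorem IsLieSymmetry.totComp_ty (hU : IsOpen U) (hX : IsLieSymmetry n U X) (hb : b ∈ U)
    (q : Var n → ℝ) (i : Fin (n - 1)) :
    totComp X b q (xv n) (yv i) + 2 * totComp X b q (yv i) (tv n) = 0 := by
  have h := hX.onShell hU hb q (Pi.single (tv n) 1) (Pi.single (yv i) 1)
  simp only [sum_single_mul] at h
  simp [Pi.single_apply] at h
  linear_combination -h + hX.base hU hb q

/-- The coefficient of `u_{x y_i}`. -/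
theorem IsLieSymmetry.totComp_xy (hU : IsOpen U) (hX : IsLieSymmetry n U X) (hb : b ∈ U)
    (q : Var n → ℝ) (i : Fin (n - 1)) :
    totComp X b q (tv n) (yv i) + 2 * b.2 * totComp X b q (xv n) (yv i)
      + 2 * totComp X b q (yv i) (xv n) = 0 := by
  have h := hX.onShell hU hb q (Pi.single (xv n) 1) (Pi.single (yv i) 1)
  simp only [sum_single_mul] at h
  simp [Pi.single_apply] at h
  linear_combination -h + hX.base hU hb q

/-- The coefficient of `u_{y_i y_j}`: at each time the transverse part is conformal. -/
theorem IsLieSymmetry.totComp_yy (hU : IsOpen U) (hX : IsLieSymmetry n U X) (hb : b ∈ U)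
    (q : Var n → ℝ) (i j : Fin (n - 1)) :
    totComp X b q (yv i) (yv j) + totComp X b q (yv j) (yv i)
      = if i = j then totComp X b q (xv n) (xv n) + totComp X b q (tv n) (tv n) else 0 := by
  have h := hX.onShell hU hb q (Pi.single (yv i) 1) (Pi.single (yv j) 1)
  have h0 := hX.base hU hb q
  simp only [sum_single_mul, hX.totComp_xt hU hb] at h h0
  by_cases hij : i = j
  · subst hij
    simp [Pi.single_apply, Finset.sum_add_distrib] at h ⊢
    linear_combination (-1/2) * h + 1/2 * h0
  · simp [Pi.single_apply, Finset.sum_add_distrib, hij, Ne.symm hij] at h ⊢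
    linear_combination (-1/2) * h + 1/2 * h0

/-- A total derivative that vanishes at all first jets has vanishing coefficients in `u_k`. -/
theorem pd_eq_zero_of_dirD {f : J0 n → ℝ} {k : Var n} (h : ∀ q, pd (dirD q k) f b = 0) :
    pd (dirI k) f b = 0 ∧ pd (dirU n) f b = 0 := by
  have h0 := h 0
  have h1 := h (fun _ => 1)
  rw [pd_dirD] at h0 h1
  simp at h0 h1
  rw [h0] at h1
  simpa [h0] using h1

theorem pd_expand (v : J0 n) (f : J0 n → ℝ) (b : J0 n) :
    pd v f b = v.1 (tv n) * pd (dirI (tv n)) f b + v.1 (xv n) * pd (dirI (xv n)) f b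
      + ∑ i, v.1 (yv i) * pd (dirI (yv i)) f b + v.2 * pd (dirU n) f b := by
  have hv : v = v.1 (tv n) • dirI (tv n) + v.1 (xv n) • dirI (xv n)
      + ∑ i : Fin (n - 1), v.1 (yv i) • dirI (yv i) + v.2 • dirU n := by
    refine Prod.ext ?_ ?_
    · funext k
      rcases k with k | k
      · fin_cases k <;> simp [dirI, dirU, Prod.fst_sum, Finset.sum_apply]
      · simp [dirI, dirU, Prod.fst_sum, Finset.sum_apply, Pi.single_apply]
    · simp [dirI, dirU, Prod.snd_sum]
  conv_lhs => rw [hv]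
  simp [pd, map_sum]

/-! ### Functions of time -/

theorem isOpen_times (hU : IsOpen U) : IsOpen (times U) :=
  ((isOpenMap_eval (tv n)).comp isOpenMap_fst) U hU

theorem convex_times (hU : Convex ℝ U) : Convex ℝ (times U) :=
  hU.linear_image ((LinearMap.proj (R := ℝ) (φ := fun _ : Var n => ℝ) (tv n)).comp
    (LinearMap.fst ℝ (Var n → ℝ) ℝ))

theorem mem_times (hb : b ∈ U) : b.1 (tv n) ∈ times U := ⟨b, hb, rfl⟩

/-- On a convex open set, a function that is constant in all directions but `∂_t` is a function
of `t`, because the fibres of `t` are convex. -/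
theorem exists_eq_time (hU : IsOpen U) (hUc : Convex ℝ U) {g : J0 n → ℝ}
    (hg : ContDiffOn ℝ ∞ g U) (hx : ∀ b ∈ U, pd (dirI (xv n)) g b = 0)
    (hy : ∀ b ∈ U, ∀ i, pd (dirI (yv i)) g b = 0) (hu : ∀ b ∈ U, pd (dirU n) g b = 0) :
    ∃ f : ℝ → ℝ, ContDiffOn ℝ ∞ f (times U) ∧ ∀ b ∈ U, g b = f (b.1 (tv n)) := by
  have hconst : ∀ b ∈ U, ∀ b' ∈ U, b.1 (tv n) = b'.1 (tv n) → g b = g b' := by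
    intro b hb b' hb' htt
    have hmem : ∀ s ∈ Set.Icc (0 : ℝ) 1, b + s • (b' - b) ∈ U := fun s hs =>
      hUc.add_smul_sub_mem hb hb' hs
    have hder : ∀ s ∈ Set.Icc (0 : ℝ) 1, HasDerivAt (fun s : ℝ => g (b + s • (b' - b))) 0 s := by
      intro s hs
      have h1 : HasDerivAt (fun s : ℝ => b + s • (b' - b)) (b' - b) s := by
        simpa using ((hasDerivAt_id s).smul_const (b' - b)).const_add b
      have h2 := (differentiableAt_of_smooth hU hg (hmem s hs)).hasFDerivAt.comp_hasDerivAt s h1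
      have h3 : pd (b' - b) g (b + s • (b' - b)) = 0 := by
        rw [pd_expand]
        simp [hx _ (hmem s hs), hy _ (hmem s hs), hu _ (hmem s hs), htt]
      change HasDerivAt _ (pd (b' - b) g (b + s • (b' - b))) s at h2
      rwa [h3] at h2
    have h := constant_of_has_deriv_right_zero
      (fun s hs => (hder s hs).continuousAt.continuousWithinAt)
      (fun s hs => (hder s ⟨hs.1, hs.2.le⟩).hasDerivWithinAt) 1 (by simp)
    simpa using h.symm
  classical
  let f : ℝ → ℝ := fun t => if h : ∃ b ∈ U, b.1 (tv n) = t then g h.choose else 0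
  have hf : ∀ b ∈ U, g b = f (b.1 (tv n)) := by
    intro b hb
    have h : ∃ b' ∈ U, b'.1 (tv n) = b.1 (tv n) := ⟨b, hb, rfl⟩
    simp only [f, dif_pos h]
    exact hconst _ hb _ h.choose_spec.1 h.choose_spec.2.symm
  refine ⟨f, ?_, hf⟩
  rintro _ ⟨b, hb, rfl⟩
  apply ContDiffAt.contDiffWithinAt
  -- near the time of `b`, the function is read off along the line through `b` in direction `∂_t`
  let γ : ℝ → J0 n := fun t => b + (t - b.1 (tv n)) • dirI (tv n)
  have hγ : ContDiff ℝ ∞ γ := by fun_prop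
  have hγb : γ (b.1 (tv n)) = b := by simp [γ]
  have hγt : ∀ t, (γ t).1 (tv n) = t := fun t => by simp [γ, dirI]
  have hg' : ContDiffAt ℝ ∞ (g ∘ γ) (b.1 (tv n)) :=
    ContDiffAt.comp _ (by rw [hγb]; exact hg.contDiffAt (hU.mem_nhds hb)) hγ.contDiffAt
  refine hg'.congr_of_eventuallyEq ?_
  have : ∀ᶠ t in nhds (b.1 (tv n)), γ t ∈ U :=
    hγ.continuous.continuousAt.eventually_mem (by rw [hγb]; exact hU.mem_nhds hb)
  filter_upwards [this] with t ht
  rw [Function.comp, hf _ ht, hγt]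

theorem hasDerivAt_of_smooth {I : Set ℝ} (hI : IsOpen I) {f : ℝ → ℝ} (hf : ContDiffOn ℝ ∞ f I)
    {t : ℝ} (ht : t ∈ I) : HasDerivAt f (deriv f t) t :=
  ((hf.contDiffAt (hI.mem_nhds ht)).differentiableAt (by simp)).hasDerivAt

theorem contDiffOn_deriv {I : Set ℝ} (hI : IsOpen I) {f : ℝ → ℝ} (hf : ContDiffOn ℝ ∞ f I) :
    ContDiffOn ℝ ∞ (deriv f) I :=
  ((contDiffOn_infty_iff_deriv_of_isOpen hI).1 hf).2

theorem contDiffOn_time {f : ℝ → ℝ} (hf : ContDiffOn ℝ ∞ f (times U)) :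
    ContDiffOn ℝ ∞ (fun b : J0 n => f (b.1 (tv n))) U :=
  hf.comp ((contDiff_apply ℝ ℝ (tv n)).comp contDiff_fst).contDiffOn fun _ hb => mem_times hb

/-- A function that is smooth on `I` with vanishing derivative there is constant on `I`. -/
theorem exists_eq_const {I : Set ℝ} (hI : IsOpen I) (hIc : Convex ℝ I) {f : ℝ → ℝ}
    (hf : ContDiffOn ℝ ∞ f I) (h : ∀ t ∈ I, deriv f t = 0) : ∃ c, ∀ t ∈ I, f t = c :=
  hI.exists_is_const_of_deriv_eq_zero hIc.isPreconnected (hf.differentiableOn (by simp)) h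

end

section

variable {n : ℕ} {U : Set (J0 n)} {X : J0 n → J0 n} {b : J0 n}

/-! ### Polynomials in `x`, `y`, `u` with coefficients depending on time -/

/-- The function `a(t) x + m(t) |y|² + ∑ e_i(t) y_i + k(t) + r(t) u`. All components of the
symmetries are of this form, and the form is stable under directional derivatives. -/
def qf {n : ℕ} (a m : ℝ → ℝ) (e : Fin (n - 1) → ℝ → ℝ) (k r : ℝ → ℝ) (b : J0 n) : ℝ :=
  a (b.1 (tv n)) * b.1 (xv n) + m (b.1 (tv n)) * ∑ i, b.1 (yv i) ^ 2
    + ∑ i, e i (b.1 (tv n)) * b.1 (yv i) + k (b.1 (tv n)) + r (b.1 (tv n)) * b.2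

theorem hasFDerivAt_coord (k : Var n) (b : J0 n) :
    HasFDerivAt (fun b : J0 n => b.1 k)
      ((ContinuousLinearMap.proj (R := ℝ) (φ := fun _ : Var n => ℝ) k).comp
        (ContinuousLinearMap.fst ℝ (Var n → ℝ) ℝ)) b :=
  ((ContinuousLinearMap.proj (R := ℝ) (φ := fun _ : Var n => ℝ) k).comp
        (ContinuousLinearMap.fst ℝ (Var n → ℝ) ℝ)).hasFDerivAt

theorem hasFDerivAt_qf {a m k r a' m' k' r' : ℝ → ℝ} {e e' : Fin (n - 1) → ℝ → ℝ}
    (ha : HasDerivAt a (a' (b.1 (tv n))) (b.1 (tv n)))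
    (hm : HasDerivAt m (m' (b.1 (tv n))) (b.1 (tv n)))
    (he : ∀ i, HasDerivAt (e i) (e' i (b.1 (tv n))) (b.1 (tv n)))
    (hk : HasDerivAt k (k' (b.1 (tv n))) (b.1 (tv n)))
    (hr : HasDerivAt r (r' (b.1 (tv n))) (b.1 (tv n))) :
    ∃ L : J0 n →L[ℝ] ℝ, HasFDerivAt (qf a m e k r) L b ∧
      ∀ v : J0 n, L v = qf (fun t => a' t * v.1 (tv n)) (fun t => m' t * v.1 (tv n))
        (fun i t => e' i t * v.1 (tv n) + 2 * m t * v.1 (yv i))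
        (fun t => a t * v.1 (xv n) + ∑ i, e i t * v.1 (yv i) + k' t * v.1 (tv n) + r t * v.2)
        (fun t => r' t * v.1 (tv n)) b := by
  have ht := hasFDerivAt_coord (tv n) b
  have hx := hasFDerivAt_coord (xv n) b
  have hy := fun i : Fin (n - 1) => hasFDerivAt_coord (yv i) b
  have hu : HasFDerivAt (fun b : J0 n => b.2) (ContinuousLinearMap.snd ℝ (Var n → ℝ) ℝ) b :=
    (ContinuousLinearMap.snd ℝ (Var n → ℝ) ℝ).hasFDerivAt
  have h : HasFDerivAt (qf a m e k r) _ b :=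
    (((((ha.comp_hasFDerivAt b ht).mul hx).add ((hm.comp_hasFDerivAt b ht).mul
      (HasFDerivAt.fun_sum (u := Finset.univ) fun i _ => (hy i).pow 2))).add
      (HasFDerivAt.fun_sum (u := Finset.univ) fun i _ =>
        ((he i).comp_hasFDerivAt b ht).mul (hy i))).add (hk.comp_hasFDerivAt b ht)).add
      ((hr.comp_hasFDerivAt b ht).mul hu)
  refine ⟨_, h, fun v => ?_⟩
  have key : m (b.1 (tv n)) * ∑ i, 2 * b.1 (yv i) * v.1 (yv i)
      + ∑ i, (e i (b.1 (tv n)) * v.1 (yv i) + b.1 (yv i) * (e' i (b.1 (tv n)) * v.1 (tv n)))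
      = ∑ i, (e' i (b.1 (tv n)) * v.1 (tv n) + 2 * m (b.1 (tv n)) * v.1 (yv i)) * b.1 (yv i)
      + ∑ i, e i (b.1 (tv n)) * v.1 (yv i) := by
    rw [Finset.mul_sum, ← Finset.sum_add_distrib, ← Finset.sum_add_distrib]
    exact Finset.sum_congr rfl fun i _ => by ring
  simp [qf]
  linear_combination key

theorem pd_qf {a m k r a' m' k' r' : ℝ → ℝ} {e e' : Fin (n - 1) → ℝ → ℝ}
    (ha : ∀ t ∈ times U, HasDerivAt a (a' t) t) (hm : ∀ t ∈ times U, HasDerivAt m (m' t) t)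
    (he : ∀ i, ∀ t ∈ times U, HasDerivAt (e i) (e' i t) t)
    (hk : ∀ t ∈ times U, HasDerivAt k (k' t) t) (hr : ∀ t ∈ times U, HasDerivAt r (r' t) t)
    (hb : b ∈ U) (v : J0 n) :
    pd v (qf a m e k r) b = qf (fun t => a' t * v.1 (tv n)) (fun t => m' t * v.1 (tv n))
        (fun i t => e' i t * v.1 (tv n) + 2 * m t * v.1 (yv i))
        (fun t => a t * v.1 (xv n) + ∑ i, e i t * v.1 (yv i) + k' t * v.1 (tv n) + r t * v.2)
        (fun t => r' t * v.1 (tv n)) b := by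
  have ht := mem_times hb
  obtain ⟨L, hL, hL'⟩ := hasFDerivAt_qf (ha _ ht) (hm _ ht) (fun i => he i _ ht) (hk _ ht) (hr _ ht)
  rw [pd, hL.fderiv, hL']

theorem contDiffOn_qf {a m k r : ℝ → ℝ} {e : Fin (n - 1) → ℝ → ℝ}
    (ha : ContDiffOn ℝ ∞ a (times U)) (hm : ContDiffOn ℝ ∞ m (times U))
    (he : ∀ i, ContDiffOn ℝ ∞ (e i) (times U)) (hk : ContDiffOn ℝ ∞ k (times U))
    (hr : ContDiffOn ℝ ∞ r (times U)) : ContDiffOn ℝ ∞ (qf (n := n) a m e k r) U := by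
  have hc : ∀ k : Var n, ContDiffOn ℝ ∞ (fun b : J0 n => b.1 k) U := fun k =>
    ((contDiff_apply ℝ ℝ k).comp contDiff_fst).contDiffOn
  exact (((((contDiffOn_time ha).mul (hc _)).add ((contDiffOn_time hm).mul
    (ContDiffOn.sum fun i _ => (hc _).pow 2))).add
    (ContDiffOn.sum fun i _ => (contDiffOn_time (he i)).mul (hc _))).add
    (contDiffOn_time hk)).add ((contDiffOn_time hr).mul contDiff_snd.contDiffOn)

theorem pd_sub {f g : J0 n → ℝ} (hU : IsOpen U) (hf : ContDiffOn ℝ ∞ f U)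
    (hg : ContDiffOn ℝ ∞ g U) (hb : b ∈ U) (v : J0 n) :
    pd v (fun b => f b - g b) b = pd v f b - pd v g b := by
  simp only [pd]
  rw [fderiv_fun_sub (differentiableAt_of_smooth hU hf hb) (differentiableAt_of_smooth hU hg hb)]
  rfl

theorem pd_add {f g : J0 n → ℝ} (hU : IsOpen U) (hf : ContDiffOn ℝ ∞ f U)
    (hg : ContDiffOn ℝ ∞ g U) (hb : b ∈ U) (v : J0 n) :
    pd v (fun b => f b + g b) b = pd v f b + pd v g b := by
  simp only [pd]
  rw [fderiv_fun_add (differentiableAt_of_smooth hU hf hb) (differentiableAt_of_smooth hU hg hb)]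
  rfl

theorem pd_const_mul {f : J0 n → ℝ} (hU : IsOpen U) (hf : ContDiffOn ℝ ∞ f U) (hb : b ∈ U)
    (c : ℝ) (v : J0 n) : pd v (fun b => c * f b) b = c * pd v f b := by
  simp only [pd]
  rw [fderiv_const_mul (differentiableAt_of_smooth hU hf hb)]
  rfl

theorem pd_eq_zero (hU : IsOpen U) {f : J0 n → ℝ} (h : ∀ b ∈ U, f b = 0) (hb : b ∈ U)
    (v : J0 n) : pd v f b = 0 := by
  rw [pd_congr hU (g := fun _ => 0) (fun b hb => h b hb) v hb]
  simp [pd]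

theorem pd_time (hU : IsOpen U) {g : J0 n → ℝ} {f : ℝ → ℝ} (hf : ContDiffOn ℝ ∞ f (times U))
    (h : ∀ b ∈ U, g b = f (b.1 (tv n))) (hb : b ∈ U) (v : J0 n) :
    pd v g b = deriv f (b.1 (tv n)) * v.1 (tv n) := by
  rw [pd_congr hU (fun b hb => h b hb) v hb, pd]
  have := (hasDerivAt_of_smooth (isOpen_times hU) hf (mem_times hb)).comp_hasFDerivAt b
    (hasFDerivAt_coord (tv n) b)
  change fderiv ℝ (f ∘ fun b : J0 n => b.1 (tv n)) b v = _
  rw [this.fderiv]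
  simp

/-- The `u`-derivative of `u g`. -/
theorem pd_dirU_mul {g : J0 n → ℝ} (hU : IsOpen U) (hg : ContDiffOn ℝ ∞ g U) (hb : b ∈ U) :
    pd (dirU n) (fun b => b.2 * g b) b = g b + b.2 * pd (dirU n) g b := by
  have hu : HasFDerivAt (fun b : J0 n => b.2) (ContinuousLinearMap.snd ℝ (Var n → ℝ) ℝ) b :=
    (ContinuousLinearMap.snd ℝ (Var n → ℝ) ℝ).hasFDerivAt
  have h := hu.mul (differentiableAt_of_smooth hU hg hb).hasFDerivAt
  rw [pd]
  change fderiv ℝ ((fun b : J0 n => b.2) * g) b (dirU n) = _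
  rw [h.fderiv]
  simp [pd, dirU]
  ring

/-! ### First-order determining equations -/

/-- The components `τ`, `ξ`, `ξ_i` do not depend on `u`, because the coefficient equations hold for
all values of the first derivatives of `u`. -/
theorem IsLieSymmetry.comp_dirU (hn : 2 < n) (hU : IsOpen U) (hX : IsLieSymmetry n U X)
    (hb : b ∈ U) (k : Var n) : pd (dirU n) (comp X k) b = 0 := by
  have hT := pd_eq_zero_of_dirD fun q => hX.totComp_xt hU hb q
  have hW : ∀ i, pd (dirU n) (comp X (yv i)) b = 0 := by
    intro i
    have h0 := hX.totComp_ty hU hb 0 i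
    have h1 := hX.totComp_ty hU hb (Pi.single (xv n) 1) i
    simp only [totComp, pd_dirD, hT.2] at h0 h1
    simp at h0 h1
    linear_combination h1 - h0
  rcases k with k | i
  · fin_cases k
    · exact hT.2
    · have h0 := hX.totComp_yy hU hb 0 ⟨0, by omega⟩ ⟨0, by omega⟩
      have h1 := hX.totComp_yy hU hb (Pi.single (xv n) 1) ⟨0, by omega⟩ ⟨0, by omega⟩
      simp only [totComp, pd_dirD, hT.2, hW] at h0 h1
      simp at h0 h1
      change pd (dirU n) (comp X (xv n)) b = 0
      linear_combination h0 - h1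
  · exact hW i

theorem IsLieSymmetry.totComp_eq (hn : 2 < n) (hU : IsOpen U) (hX : IsLieSymmetry n U X)
    (hb : b ∈ U) (q : Var n → ℝ) (i k : Var n) : totComp X b q i k = pd (dirI i) (comp X k) b := by
  rw [totComp, pd_dirD, hX.comp_dirU hn hU hb]
  simp

/-- `∂_x ξ^i = 0`, by differentiating the `xy_i`-equation in `u`. -/
theorem IsLieSymmetry.compY_x (hn : 2 < n) (hU : IsOpen U) (hX : IsLieSymmetry n U X)
    (hb : b ∈ U) (i : Fin (n - 1)) : pd (dirI (xv n)) (comp X (yv i)) b = 0 := by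
  have hs := contDiffOn_comp hX.1
  have h0 : ∀ b ∈ U, (pd (dirI (tv n)) (comp X (yv i)) b
      + 2 * (b.2 * pd (dirI (xv n)) (comp X (yv i)) b))
      + 2 * pd (dirI (yv i)) (comp X (xv n)) b = 0 := by
    intro b hb
    have := hX.totComp_xy hU hb 0 i
    simp only [hX.totComp_eq hn hU hb] at this
    linear_combination this
  have hz : ∀ k l, pd (dirU n) (pd (dirI k) (comp X l)) b = 0 := fun k l => by
    rw [pd_comm hU (hs l) hb]
    exact pd_eq_zero hU (fun b hb => hX.comp_dirU hn hU hb l) hb _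
  have h1 := pd_eq_zero hU h0 hb (dirU n)
  have s1 : ∀ k l, ContDiffOn ℝ ∞ (pd (dirI k) (comp X l)) U := fun k l =>
    contDiffOn_pd hU (hs l) _
  have s2 : ContDiffOn ℝ ∞ (fun b : J0 n => b.2 * pd (dirI (xv n)) (comp X (yv i)) b) U :=
    contDiff_snd.contDiffOn.mul (s1 _ _)
  rw [pd_add hU ((s1 _ _).add (contDiffOn_const.mul s2)) (contDiffOn_const.mul (s1 _ _)) hb,
    pd_add hU (s1 _ _) (contDiffOn_const.mul s2) hb, pd_const_mul hU s2 hb,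
    pd_const_mul hU (s1 _ _) hb, pd_dirU_mul hU (s1 _ _) hb, hz, hz, hz] at h1
  linarith

end

section

variable {n : ℕ} {U : Set (J0 n)} {X : J0 n → J0 n} {b : J0 n}

/-! ### The general solution of the first-order determining equations -/

/-- The general solution of the first-order part of the determining equations. It depends on
arbitrary functions `τ`, `μ`, `F_i`, `F_n` of time and a constant matrix `c`; the remaining
determining equations are ordinary differential equations for `τ` and `μ`. -/
noncomputable def ansatz (τ μ : ℝ → ℝ) (c : Matrix (Fin (n - 1)) (Fin (n - 1)) ℝ)
    (F : Fin (n - 1) → ℝ → ℝ) (Fn : ℝ → ℝ) (b : J0 n) : J0 n :=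
  vec (τ (b.1 (tv n)))
    (qf (fun t => μ t - deriv τ t) (fun t => -(deriv μ t) / 8)
      (fun i t => -(deriv (F i) t) / 2) Fn 0 b)
    (fun i => μ (b.1 (tv n)) / 2 * b.1 (yv i) + ∑ j, c i j * b.1 (yv j) + F i (b.1 (tv n)))
    (qf (fun t => deriv μ t - deriv (deriv τ) t) (fun t => -(deriv (deriv μ) t) / 8)
      (fun i t => -(deriv (deriv (F i)) t) / 2) (deriv Fn) (fun t => μ t - 2 * deriv τ t) b)

theorem pd_pd_eq_zero (hU : IsOpen U) {f : J0 n → ℝ} (hf : ContDiffOn ℝ ∞ f U) (v w : J0 n)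
    (h : ∀ b ∈ U, pd v f b = 0) (hb : b ∈ U) : pd v (pd w f) b = 0 := by
  rw [pd_comm hU hf hb]
  exact pd_eq_zero hU h hb w

/-- The first-order determining equations on `U`, in solved form. A field `k_l` concerns the
derivative of `ξ^k` in the variable `l`, except that `y_t` expresses `∂_{y_i} ξ` through `∂_t ξ_i`;
the field `u` expresses `η`. -/
structure FirstOrder (U : Set (J0 n)) (X : J0 n → J0 n) : Prop where
  smooth : ContDiffOn ℝ ∞ X U
  dirU : ∀ b ∈ U, ∀ k, pd (dirU n) (comp X k) b = 0
  t_x : ∀ b ∈ U, pd (dirI (xv n)) (comp X (tv n)) b = 0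
  t_y : ∀ b ∈ U, ∀ i, pd (dirI (yv i)) (comp X (tv n)) b = 0
  y_x : ∀ b ∈ U, ∀ i, pd (dirI (xv n)) (comp X (yv i)) b = 0
  y_t : ∀ b ∈ U, ∀ i, pd (dirI (yv i)) (comp X (xv n)) b
    = -1 / 2 * pd (dirI (tv n)) (comp X (yv i)) b
  y_y : ∀ b ∈ U, ∀ i j, pd (dirI (yv i)) (comp X (yv j)) b + pd (dirI (yv j)) (comp X (yv i)) b
    = if i = j then pd (dirI (xv n)) (comp X (xv n)) b + pd (dirI (tv n)) (comp X (tv n)) b else 0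
  u : ∀ b ∈ U, compU X b = pd (dirI (tv n)) (comp X (xv n)) b
    + b.2 * (pd (dirI (xv n)) (comp X (xv n)) b - pd (dirI (tv n)) (comp X (tv n)) b)

theorem IsLieSymmetry.firstOrder (hn : 2 < n) (hU : IsOpen U) (hX : IsLieSymmetry n U X) :
    FirstOrder U X where
  smooth := hX.1
  dirU b hb k := hX.comp_dirU hn hU hb k
  t_x b hb := by rw [← hX.totComp_eq hn hU hb 0]; exact hX.totComp_xt hU hb 0
  t_y b hb i := by
    have h := hX.totComp_ty hU hb 0 i
    simp only [hX.totComp_eq hn hU hb, hX.compY_x hn hU hb] at h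
    linarith
  y_x b hb i := hX.compY_x hn hU hb i
  y_t b hb i := by
    have h := hX.totComp_xy hU hb 0 i
    simp only [hX.totComp_eq hn hU hb, hX.compY_x hn hU hb] at h
    linarith
  y_y b hb i j := by
    have h := hX.totComp_yy hU hb 0 i j
    simpa only [hX.totComp_eq hn hU hb] using h
  u b hb := by
    have h := hX.totComp_xx hU hb 0
    simpa only [hX.totComp_eq hn hU hb] using h

namespace FirstOrder

theorem exists_tau (hU : IsOpen U) (hUc : Convex ℝ U) (h : FirstOrder U X) :
    ∃ τ : ℝ → ℝ, ContDiffOn ℝ ∞ τ (times U) ∧ ∀ b ∈ U, comp X (tv n) b = τ (b.1 (tv n)) :=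
  exists_eq_time hU hUc (contDiffOn_comp h.smooth _) h.t_x h.t_y fun b hb => h.dirU b hb _

/-- `ξ_x + τ_t`, which is the conformal factor of the transverse part, depends on time only. -/
theorem exists_mu (hn : 2 < n) (hU : IsOpen U) (hUc : Convex ℝ U) (h : FirstOrder U X) :
    ∃ μ : ℝ → ℝ, ContDiffOn ℝ ∞ μ (times U) ∧ ∀ b ∈ U, pd (dirI (xv n)) (comp X (xv n)) b
      + pd (dirI (tv n)) (comp X (tv n)) b = μ (b.1 (tv n)) := by
  have hs := contDiffOn_comp h.smooth
  have s1 : ∀ k l, ContDiffOn ℝ ∞ (pd (dirI k) (comp X l)) U := fun k l =>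
    contDiffOn_pd hU (hs l) _
  have hu : ∀ b ∈ U, ∀ k l, pd (DKP.dirU n) (pd (dirI k) (comp X l)) b = 0 := fun b hb k l =>
    pd_pd_eq_zero hU (hs l) _ _ (fun b hb => h.dirU b hb l) hb
  refine exists_eq_time hU hUc ((s1 _ _).add (s1 _ _)) ?_ ?_ ?_
  · intro b hb
    let i : Fin (n - 1) := ⟨0, by omega⟩
    have e : Set.EqOn (fun b => pd (dirI (xv n)) (comp X (xv n)) b
        + pd (dirI (tv n)) (comp X (tv n)) b)
        (fun b => 2 * pd (dirI (yv i)) (comp X (yv i)) b) U := fun b hb => by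
      have := h.y_y b hb i i
      simp only [if_true] at this
      simp only
      linarith
    rw [pd_congr hU e _ hb, pd_const_mul hU (s1 _ _) hb,
      pd_pd_eq_zero hU (hs _) _ _ (fun b hb => h.y_x b hb i) hb, mul_zero]
  · intro b hb i
    rw [pd_add hU (s1 _ _) (s1 _ _) hb,
      pd_pd_eq_zero hU (hs (tv n)) _ _ (fun b hb => h.t_y b hb i) hb,
      pd_comm hU (hs _) hb, pd_congr hU (fun b hb => h.y_t b hb i) _ hb,
      pd_const_mul hU (s1 _ _) hb,
      pd_pd_eq_zero hU (hs _) _ _ (fun b hb => h.y_x b hb i) hb]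
    simp
  · intro b hb
    rw [pd_add hU (s1 _ _) (s1 _ _) hb, hu b hb, hu b hb, add_zero]

/-- The transverse part is a Killing field up to homotheties at each time, so its second transverse
derivatives vanish. -/
theorem killing (hU : IsOpen U) (h : FirstOrder U X) {μ : ℝ → ℝ}
    (hμs : ContDiffOn ℝ ∞ μ (times U))
    (hμ : ∀ b ∈ U, pd (dirI (xv n)) (comp X (xv n)) b
      + pd (dirI (tv n)) (comp X (tv n)) b = μ (b.1 (tv n))) (hb : b ∈ U) (i j k : Fin (n - 1)) :
    pd (dirI (yv k)) (pd (dirI (yv j)) (comp X (yv i))) b = 0 := by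
  have hs := contDiffOn_comp h.smooth
  have s1 : ∀ k l, ContDiffOn ℝ ∞ (pd (dirI k) (comp X l)) U := fun k l =>
    contDiffOn_pd hU (hs l) _
  have anti : ∀ i j k : Fin (n - 1), pd (dirI (yv k)) (pd (dirI (yv j)) (comp X (yv i))) b
      = - pd (dirI (yv k)) (pd (dirI (yv i)) (comp X (yv j))) b := by
    intro i j k
    have e : ∀ b ∈ U, pd (dirI (yv i)) (comp X (yv j)) b + pd (dirI (yv j)) (comp X (yv i)) b
        = (fun t => if i = j then μ t else 0) (b.1 (tv n)) := fun b hb => by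
      rw [h.y_y b hb, hμ b hb]
    have es : ContDiffOn ℝ ∞ (fun t => if i = j then μ t else 0) (times U) := by
      split_ifs
      exacts [hμs, contDiffOn_const]
    have := pd_time hU es e hb (dirI (yv k))
    rw [pd_add hU (s1 _ _) (s1 _ _) hb] at this
    simp [dirI] at this
    simp only [dirI]
    linarith
  have sym : ∀ i j k : Fin (n - 1), pd (dirI (yv k)) (pd (dirI (yv j)) (comp X (yv i))) b
      = pd (dirI (yv j)) (pd (dirI (yv k)) (comp X (yv i))) b := fun i j k => pd_comm hU (hs _) hb _ _
  -- `∂_k ∂_j ξ_i` is antisymmetric in `i, j` and symmetric in `j, k`, hence zero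
  linarith [anti i j k, sym j i k, anti j k i, sym k j i, anti k i j, sym i j k]

theorem exists_grad (hU : IsOpen U) (hUc : Convex ℝ U) (h : FirstOrder U X) {μ : ℝ → ℝ}
    (hμs : ContDiffOn ℝ ∞ μ (times U))
    (hμ : ∀ b ∈ U, pd (dirI (xv n)) (comp X (xv n)) b
      + pd (dirI (tv n)) (comp X (tv n)) b = μ (b.1 (tv n))) (i j : Fin (n - 1)) :
    ∃ w : ℝ → ℝ, ContDiffOn ℝ ∞ w (times U) ∧
      ∀ b ∈ U, pd (dirI (yv j)) (comp X (yv i)) b = w (b.1 (tv n)) := by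
  have hs := contDiffOn_comp h.smooth
  refine exists_eq_time hU hUc (contDiffOn_pd hU (hs _) _) ?_ ?_ ?_
  · exact fun b hb => pd_pd_eq_zero hU (hs _) _ _ (fun b hb => h.y_x b hb i) hb
  · exact fun b hb k => h.killing hU hμs hμ hb i j k
  · exact fun b hb => pd_pd_eq_zero hU (hs _) _ _ (fun b hb => h.dirU b hb _) hb

/-- The rotational part does not depend on time, because `∂_{y_j} ξ^i_t = -2 ξ_{y_i y_j}` is
symmetric in `i` and `j`. -/
theorem exists_rotation (hU : IsOpen U) (hUc : Convex ℝ U) (hUne : U.Nonempty)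
    (h : FirstOrder U X) {μ : ℝ → ℝ} (hμs : ContDiffOn ℝ ∞ μ (times U))
    (hμ : ∀ b ∈ U, pd (dirI (xv n)) (comp X (xv n)) b
      + pd (dirI (tv n)) (comp X (tv n)) b = μ (b.1 (tv n))) :
    ∃ c : Matrix (Fin (n - 1)) (Fin (n - 1)) ℝ, (∀ i j, c i j = -c j i) ∧
      ∀ b ∈ U, ∀ i j, pd (dirI (yv j)) (comp X (yv i)) b
        = (if i = j then μ (b.1 (tv n)) / 2 else 0) + c i j := by
  have hs := contDiffOn_comp h.smooth
  have hI := isOpen_times hU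
  choose w hws hw using fun i j => h.exists_grad hU hUc hμs hμ i j
  have s1 : ∀ k l, ContDiffOn ℝ ∞ (pd (dirI k) (comp X l)) U := fun k l =>
    contDiffOn_pd hU (hs l) _
  have hsum : ∀ i j, ∀ t ∈ times U, w i j t + w j i t = if i = j then μ t else 0 := by
    rintro i j _ ⟨b, hb, rfl⟩
    simp only
    rw [← hw i j b hb, ← hw j i b hb, add_comm, h.y_y b hb, hμ b hb]
  have hdsum : ∀ i j, ∀ t ∈ times U, deriv (w i j) t + deriv (w j i) t
      = if i = j then deriv μ t else 0 := by
    intro i j t ht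
    have e : (fun t => w i j t + w j i t) =ᶠ[nhds t] fun t => if i = j then μ t else 0 :=
      Filter.eventuallyEq_of_mem (hI.mem_nhds ht) (hsum i j)
    have e1 := ((hasDerivAt_of_smooth hI (hws i j) ht).add
      (hasDerivAt_of_smooth hI (hws j i) ht)).deriv
    change deriv (fun t => w i j t + w j i t) t = _ at e1
    rw [← e1, e.deriv_eq]
    split_ifs <;> simp
  have hsym : ∀ i j, ∀ t ∈ times U, deriv (w i j) t = deriv (w j i) t := by
    have key : ∀ i j, ∀ b ∈ U, deriv (w i j) (b.1 (tv n))
        = -2 * pd (dirI (yv j)) (pd (dirI (yv i)) (comp X (xv n))) b := by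
      intro i j b hb
      have h1 := pd_time hU (hws i j) (hw i j) hb (dirI (tv n))
      rw [pd_comm hU (hs _) hb] at h1
      rw [pd_congr hU (fun b hb => h.y_t b hb i) _ hb, pd_const_mul hU (s1 _ _) hb, h1]
      simp [dirI]
      ring
    rintro i j _ ⟨b, hb, rfl⟩
    simp only
    rw [key i j b hb, key j i b hb, pd_comm hU (hs _) hb]
  have hc : ∀ i j, ∃ c : ℝ, ∀ t ∈ times U, w i j t - (if i = j then μ t / 2 else 0) = c := by
    intro i j
    have hsm : ContDiffOn ℝ ∞ (fun t => if i = j then μ t / 2 else 0) (times U) := by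
      split_ifs
      exacts [hμs.div_const _, contDiffOn_const]
    refine exists_eq_const hI (convex_times hUc) ((hws i j).sub hsm) fun t ht => ?_
    have h1 := hdsum i j t ht
    have h2 := hsym i j t ht
    have h3 : HasDerivAt (fun t => if i = j then μ t / 2 else 0)
        (if i = j then deriv μ t / 2 else 0) t := by
      split_ifs
      exacts [(hasDerivAt_of_smooth hI hμs ht).div_const 2, hasDerivAt_const _ _]
    rw [show deriv (fun t => w i j t - if i = j then μ t / 2 else 0) t = _ from
      ((hasDerivAt_of_smooth hI (hws i j) ht).sub h3).deriv]
    split_ifs at h1 ⊢ <;> linarith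
  choose c hc using hc
  refine ⟨c, fun i j => ?_, fun b hb i j => ?_⟩
  · obtain ⟨b, hb⟩ := hUne
    have ht := mem_times hb
    have h1 := hsum i j _ ht
    rw [← hc i j _ ht, ← hc j i _ ht]
    by_cases hij : i = j
    · subst hij
      simp at h1 ⊢
      linarith
    · simp [hij, Ne.symm hij] at h1 ⊢
      linarith
  · rw [hw i j b hb, ← hc i j _ (mem_times hb)]
    ring

/-- Integration of the first-order determining equations: subtracting from each component the part
fixed by its derivatives in `x` and `y` leaves a function of time. -/
theorem exists_ansatz (hn : 2 < n) (hU : IsOpen U) (hUc : Convex ℝ U) (hUne : U.Nonempty)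
    (h : FirstOrder U X) :
    ∃ (τ μ : ℝ → ℝ) (c : Matrix (Fin (n - 1)) (Fin (n - 1)) ℝ) (F : Fin (n - 1) → ℝ → ℝ)
      (Fn : ℝ → ℝ), (∀ i j, c i j = -c j i) ∧ ContDiffOn ℝ ∞ τ (times U) ∧
      ContDiffOn ℝ ∞ μ (times U) ∧ (∀ i, ContDiffOn ℝ ∞ (F i) (times U)) ∧
      ContDiffOn ℝ ∞ Fn (times U) ∧ Set.EqOn X (ansatz τ μ c F Fn) U := by
  have hs := contDiffOn_comp h.smooth
  have hI := isOpen_times hU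
  obtain ⟨τ, hτs, hτ⟩ := h.exists_tau hU hUc
  obtain ⟨μ, hμs, hμ⟩ := h.exists_mu hn hU hUc
  obtain ⟨c, hcanti, hc⟩ := h.exists_rotation hU hUc hUne hμs hμ
  have hτt : ∀ b ∈ U, pd (dirI (tv n)) (comp X (tv n)) b = deriv τ (b.1 (tv n)) := fun b hb => by
    rw [pd_time hU hτs hτ hb]; simp [dirI]
  have hd : ∀ {f : ℝ → ℝ}, ContDiffOn ℝ ∞ f (times U) → ∀ t ∈ times U, HasDerivAt f (deriv f t) t :=
    fun hf t ht => hasDerivAt_of_smooth hI hf ht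
  have h0 : ∀ t ∈ times U, HasDerivAt (0 : ℝ → ℝ) ((0 : ℝ → ℝ) t) t :=
    fun t _ => hasDerivAt_const _ _
  -- the transverse components
  have hF : ∀ i, ∃ F : ℝ → ℝ, ContDiffOn ℝ ∞ F (times U) ∧ ∀ b ∈ U, comp X (yv i) b
      - qf 0 0 (fun j t => (if i = j then μ t / 2 else 0) + c i j) 0 0 b = F (b.1 (tv n)) := by
    intro i
    have hes : ∀ j, ContDiffOn ℝ ∞ (fun t => (if i = j then μ t / 2 else 0) + c i j)
        (times U) := by
      intro j
      split_ifs
      exacts [(hμs.div_const _).add contDiffOn_const, contDiffOn_const.add contDiffOn_const]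
    have hqs : ContDiffOn ℝ ∞ (qf (n := n) 0 0
        (fun j t => (if i = j then μ t / 2 else 0) + c i j) 0 0) U :=
      contDiffOn_qf contDiffOn_const contDiffOn_const hes contDiffOn_const contDiffOn_const
    have hpd := fun (b) (hb : b ∈ U) (v) => pd_qf (n := n) h0 h0
      (fun j => hd (hes j)) h0 h0 hb v
    refine exists_eq_time hU hUc ((hs _).sub hqs) ?_ ?_ ?_
    · intro b hb
      rw [pd_sub hU (hs _) hqs hb, h.y_x b hb, hpd b hb]
      simp [qf, dirI]
    · intro b hb k
      rw [pd_sub hU (hs _) hqs hb, hc b hb, hpd b hb]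
      simp [qf, dirI, Pi.single_apply]
    · intro b hb
      rw [pd_sub hU (hs _) hqs hb, h.dirU b hb, hpd b hb]
      simp [qf, DKP.dirU]
  choose F hFs hF using hF
  have hy : ∀ b ∈ U, ∀ i, comp X (yv i) b
      = μ (b.1 (tv n)) / 2 * b.1 (yv i) + ∑ j, c i j * b.1 (yv j) + F i (b.1 (tv n)) := by
    intro b hb i
    rw [← hF i b hb]
    simp [qf, add_mul, Finset.sum_add_distrib]
  have hyt : ∀ b ∈ U, ∀ i, pd (dirI (tv n)) (comp X (yv i)) b
      = deriv μ (b.1 (tv n)) / 2 * b.1 (yv i) + deriv (F i) (b.1 (tv n)) := by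
    intro b hb i
    have hes : ∀ j, ∀ t ∈ times U, HasDerivAt (fun t => (if i = j then μ t / 2 else 0) + c i j)
        (if i = j then deriv μ t / 2 else 0) t := by
      intro j t ht
      split_ifs
      exacts [((hd hμs t ht).div_const 2).add_const _, hasDerivAt_const _ _]
    have e : Set.EqOn (comp X (yv i))
        (qf 0 0 (fun j t => (if i = j then μ t / 2 else 0) + c i j) (F i) 0) U := by
      intro b hb
      rw [hy b hb]
      simp [qf, add_mul, Finset.sum_add_distrib]
    rw [pd_congr hU e _ hb, pd_qf h0 h0 hes (hd (hFs i)) h0 hb]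
    simp [qf, dirI]
  -- the component along `∂_x`
  let a : ℝ → ℝ := fun t => μ t - deriv τ t
  let m : ℝ → ℝ := fun t => -(deriv μ t) / 8
  let e : Fin (n - 1) → ℝ → ℝ := fun i t => -(deriv (F i) t) / 2
  have has : ContDiffOn ℝ ∞ a (times U) := hμs.sub (contDiffOn_deriv hI hτs)
  have hms : ContDiffOn ℝ ∞ m (times U) := (contDiffOn_deriv hI hμs).neg.div_const 8
  have hes : ∀ i, ContDiffOn ℝ ∞ (e i) (times U) := fun i =>
    (contDiffOn_deriv hI (hFs i)).neg.div_const 2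
  have hFn : ∃ Fn : ℝ → ℝ, ContDiffOn ℝ ∞ Fn (times U) ∧
      ∀ b ∈ U, comp X (xv n) b - qf a m e 0 0 b = Fn (b.1 (tv n)) := by
    have hqs : ContDiffOn ℝ ∞ (qf (n := n) a m e 0 0) U :=
      contDiffOn_qf has hms hes contDiffOn_const contDiffOn_const
    have hpd := fun (b) (hb : b ∈ U) (v) => pd_qf (n := n) (hd has) (hd hms)
      (fun j => hd (hes j)) h0 h0 hb v
    refine exists_eq_time hU hUc ((hs _).sub hqs) ?_ ?_ ?_
    · intro b hb
      have := hμ b hb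
      rw [hτt b hb] at this
      rw [pd_sub hU (hs _) hqs hb, hpd b hb]
      simp [qf, dirI, a]
      simp only [dirI] at this
      linarith
    · intro b hb k
      rw [pd_sub hU (hs _) hqs hb, h.y_t b hb, hyt b hb, hpd b hb]
      simp [qf, dirI, Pi.single_apply, m, e]
      ring
    · intro b hb
      rw [pd_sub hU (hs _) hqs hb, h.dirU b hb, hpd b hb]
      simp [qf, DKP.dirU]
  obtain ⟨Fn, hFns, hFn⟩ := hFn
  have hx : Set.EqOn (comp X (xv n)) (qf a m e Fn 0) U := by
    intro b hb
    have := hFn b hb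
    simp [qf] at this ⊢
    linarith
  refine ⟨τ, μ, c, F, Fn, hcanti, hτs, hμs, hFs, hFns, fun b hb => ?_⟩
  refine Prod.ext (funext fun k => ?_) ?_
  · rcases k with k | i
    · fin_cases k
      · exact hτ b hb
      · exact hx hb
    · exact hy b hb i
  · have hu := h.u b hb
    have ht := mem_times hb
    have hpd := fun v => pd_qf (n := n) (hd has) (hd hms) (fun j => hd (hes j)) (hd hFns)
      h0 hb v
    have ha' : deriv a (b.1 (tv n)) = deriv μ (b.1 (tv n)) - deriv (deriv τ) (b.1 (tv n)) :=
      ((hd hμs _ ht).sub (hd (contDiffOn_deriv hI hτs) _ ht)).deriv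
    have hm' : deriv m (b.1 (tv n)) = -(deriv (deriv μ) (b.1 (tv n))) / 8 :=
      ((hd (contDiffOn_deriv hI hμs) _ ht).neg.div_const 8).deriv
    have he' : ∀ i, deriv (e i) (b.1 (tv n)) = -(deriv (deriv (F i)) (b.1 (tv n))) / 2 := fun i =>
      ((hd (contDiffOn_deriv hI (hFs i)) _ ht).neg.div_const 2).deriv
    rw [pd_congr hU hx _ hb, pd_congr hU hx _ hb, hτt b hb, hpd, hpd] at hu
    simp only [ansatz, vec]
    change compU X b = _
    rw [hu]
    simp [qf, dirI, ha', hm', he', a]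
    ring

end FirstOrder

end

section

variable {n : ℕ} {U : Set (J0 n)} {b : J0 n} {τ μ : ℝ → ℝ}
  {c : Matrix (Fin (n - 1)) (Fin (n - 1)) ℝ} {F : Fin (n - 1) → ℝ → ℝ} {Fn : ℝ → ℝ}

/-! ### Derivatives of the general first-order solution -/

theorem comp_ansatz_t : comp (ansatz τ μ c F Fn) (tv n) = qf 0 0 0 τ 0 := by
  funext b
  simp [comp, ansatz, vec, qf]

theorem comp_ansatz_x : comp (ansatz τ μ c F Fn) (xv n) =
    qf (fun t => μ t - deriv τ t) (fun t => -(deriv μ t) / 8)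
      (fun i t => -(deriv (F i) t) / 2) Fn 0 := by
  rfl

theorem comp_ansatz_y (i : Fin (n - 1)) : comp (ansatz τ μ c F Fn) (yv i) =
    qf 0 0 (fun j t => (if i = j then μ t / 2 else 0) + c i j) (F i) 0 := by
  funext b
  simp [comp, ansatz, vec, qf, add_mul, Finset.sum_add_distrib]

theorem compU_ansatz : compU (ansatz τ μ c F Fn) =
    qf (fun t => deriv μ t - deriv (deriv τ) t) (fun t => -(deriv (deriv μ) t) / 8)
      (fun i t => -(deriv (deriv (F i)) t) / 2) (deriv Fn) (fun t => μ t - 2 * deriv τ t) := by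
  rfl

/-- The coefficient functions `τ`, `μ`, `F_i`, `F_n` are smooth on `I`. -/
structure SmoothData (I : Set ℝ) (τ μ : ℝ → ℝ) {n : ℕ} (F : Fin (n - 1) → ℝ → ℝ)
    (Fn : ℝ → ℝ) : Prop where
  tau : ContDiffOn ℝ ∞ τ I
  mu : ContDiffOn ℝ ∞ μ I
  F : ∀ i, ContDiffOn ℝ ∞ (F i) I
  Fn : ContDiffOn ℝ ∞ Fn I

theorem contDiffOn_of_components {X : J0 n → J0 n} (h : ∀ k, ContDiffOn ℝ ∞ (comp X k) U)
    (hu : ContDiffOn ℝ ∞ (compU X) U) : ContDiffOn ℝ ∞ X U :=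
  (contDiffOn_pi.2 h).prodMk hu

theorem contDiffOn_ite {I : Set ℝ} {f : ℝ → ℝ} (hf : ContDiffOn ℝ ∞ f I) (p : Prop)
    [Decidable p] (d : ℝ) : ContDiffOn ℝ ∞ (fun t => (if p then f t / 2 else 0) + d) I := by
  split_ifs
  exacts [(hf.div_const _).add contDiffOn_const, contDiffOn_const.add contDiffOn_const]

theorem hasDerivAt_ite {f : ℝ → ℝ} {f' t : ℝ} (hf : HasDerivAt f f' t) (p : Prop)
    [Decidable p] (d : ℝ) :
    HasDerivAt (fun t => (if p then f t / 2 else 0) + d) (if p then f' / 2 else 0) t := by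
  split_ifs
  exacts [(hf.div_const 2).add_const _, hasDerivAt_const _ _]

theorem contDiffOn_ansatz (hU : IsOpen U) (h : SmoothData (times U) τ μ F Fn) :
    ContDiffOn ℝ ∞ (ansatz τ μ c F Fn) U := by
  have hI := isOpen_times hU
  have d : ∀ {f : ℝ → ℝ}, ContDiffOn ℝ ∞ f (times U) → ContDiffOn ℝ ∞ (deriv f) (times U) :=
    fun hf => contDiffOn_deriv hI hf
  refine contDiffOn_of_components (fun k => ?_) ?_
  · rcases k with k | i
    · fin_cases k
      · change ContDiffOn ℝ ∞ (comp _ (tv n)) U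
        rw [comp_ansatz_t]
        exact contDiffOn_qf contDiffOn_const contDiffOn_const (fun _ => contDiffOn_const) h.tau
          contDiffOn_const
      · change ContDiffOn ℝ ∞ (comp _ (xv n)) U
        rw [comp_ansatz_x]
        exact contDiffOn_qf (h.mu.sub (d h.tau)) ((d h.mu).neg.div_const _)
          (fun i => (d (h.F i)).neg.div_const _) h.Fn contDiffOn_const
    · rw [comp_ansatz_y]
      exact contDiffOn_qf contDiffOn_const contDiffOn_const
        (fun j => contDiffOn_ite h.mu _ _) (h.F i) contDiffOn_const
  · rw [compU_ansatz]
    exact contDiffOn_qf ((d h.mu).sub (d (d h.tau))) ((d (d h.mu)).neg.div_const _)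
      (fun i => (d (d (h.F i))).neg.div_const _) (d h.Fn)
      (h.mu.sub (contDiffOn_const.mul (d h.tau)))

theorem pd_ansatz_t (hU : IsOpen U) (h : SmoothData (times U) τ μ F Fn) (hb : b ∈ U) (v : J0 n) :
    pd v (comp (ansatz τ μ c F Fn) (tv n)) b = deriv τ (b.1 (tv n)) * v.1 (tv n) := by
  have h0 : ∀ t ∈ times U, HasDerivAt (0 : ℝ → ℝ) ((0 : ℝ → ℝ) t) t :=
    fun t _ => hasDerivAt_const _ _
  have d := fun t (ht : t ∈ times U) => hasDerivAt_of_smooth (isOpen_times hU) h.tau ht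
  rw [comp_ansatz_t, pd_qf (e := 0) (e' := 0) h0 h0 (fun i => h0) d h0 hb]
  simp [qf]

theorem pd_ansatz_y (hU : IsOpen U) (h : SmoothData (times U) τ μ F Fn) (hb : b ∈ U) (v : J0 n)
    (i : Fin (n - 1)) :
    pd v (comp (ansatz τ μ c F Fn) (yv i)) b = deriv μ (b.1 (tv n)) / 2 * v.1 (tv n) * b.1 (yv i)
      + μ (b.1 (tv n)) / 2 * v.1 (yv i) + ∑ j, c i j * v.1 (yv j)
      + deriv (F i) (b.1 (tv n)) * v.1 (tv n) := by
  have hI := isOpen_times hU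
  have h0 : ∀ t ∈ times U, HasDerivAt (0 : ℝ → ℝ) ((0 : ℝ → ℝ) t) t :=
    fun t _ => hasDerivAt_const _ _
  rw [comp_ansatz_y, pd_qf (e' := fun j t => if i = j then deriv μ t / 2 else 0) h0 h0
    (fun j t ht => hasDerivAt_ite (hasDerivAt_of_smooth hI h.mu ht) _ _)
    (fun t ht => hasDerivAt_of_smooth hI (h.F i) ht) h0 hb]
  simp [qf, add_mul, Finset.sum_add_distrib]
  ring

theorem pd_ansatz_x (hU : IsOpen U) (h : SmoothData (times U) τ μ F Fn) (hb : b ∈ U) (v : J0 n) :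
    pd v (comp (ansatz τ μ c F Fn) (xv n)) b =
      (μ (b.1 (tv n)) - deriv τ (b.1 (tv n))) * v.1 (xv n)
      + (deriv μ (b.1 (tv n)) - deriv (deriv τ) (b.1 (tv n))) * v.1 (tv n) * b.1 (xv n)
      - deriv (deriv μ) (b.1 (tv n)) / 8 * v.1 (tv n) * ∑ i, b.1 (yv i) ^ 2
      - deriv μ (b.1 (tv n)) / 4 * ∑ i, b.1 (yv i) * v.1 (yv i)
      - v.1 (tv n) / 2 * ∑ i, deriv (deriv (F i)) (b.1 (tv n)) * b.1 (yv i)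
      - 1 / 2 * ∑ i, deriv (F i) (b.1 (tv n)) * v.1 (yv i)
      + deriv Fn (b.1 (tv n)) * v.1 (tv n) := by
  have hI := isOpen_times hU
  have d : ∀ {f : ℝ → ℝ}, ContDiffOn ℝ ∞ f (times U) → ∀ t ∈ times U, HasDerivAt f (deriv f t) t :=
    fun hf t ht => hasDerivAt_of_smooth hI hf ht
  have d2 : ∀ {f : ℝ → ℝ}, ContDiffOn ℝ ∞ f (times U) → ∀ t ∈ times U,
      HasDerivAt (deriv f) (deriv (deriv f) t) t := fun hf => d (contDiffOn_deriv hI hf)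
  have h0 : ∀ t ∈ times U, HasDerivAt (0 : ℝ → ℝ) ((0 : ℝ → ℝ) t) t :=
    fun t _ => hasDerivAt_const _ _
  rw [comp_ansatz_x, pd_qf (a := fun t => μ t - deriv τ t)
    (m := fun t => -(deriv μ t) / 8) (e := fun i t => -(deriv (F i) t) / 2)
    (a' := fun t => deriv μ t - deriv (deriv τ) t)
    (m' := fun t => -(deriv (deriv μ) t) / 8) (e' := fun i t => -(deriv (deriv (F i)) t) / 2)
    (fun t ht => (d h.mu t ht).sub (d2 h.tau t ht)) (fun t ht => (d2 h.mu t ht).neg.div_const 8)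
    (fun i t ht => (d2 (h.F i) t ht).neg.div_const 2) (d h.Fn) h0 hb]
  simp only [qf, Finset.mul_sum, add_mul, Finset.sum_add_distrib, sub_eq_add_neg,
    ← Finset.sum_neg_distrib]
  have e1 : ∀ i : Fin (n - 1), 2 * (-deriv μ (b.1 (tv n)) / 8) * v.1 (yv i) * b.1 (yv i)
    = -(deriv μ (b.1 (tv n)) / 4 * (b.1 (yv i) * v.1 (yv i))) := fun i => by ring
  have e2 : ∀ i : Fin (n - 1), -deriv (deriv (F i)) (b.1 (tv n)) / 2 * v.1 (tv n) * b.1 (yv i)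
    = -(v.1 (tv n) / 2 * (deriv (deriv (F i)) (b.1 (tv n)) * b.1 (yv i))) := fun i => by ring
  have e3 : ∀ i : Fin (n - 1), -deriv (F i) (b.1 (tv n)) / 2 * v.1 (yv i)
    = -(1 / 2 * (deriv (F i) (b.1 (tv n)) * v.1 (yv i))) := fun i => by ring
  have e4 : ∀ i : Fin (n - 1), -deriv (deriv μ) (b.1 (tv n)) / 8 * v.1 (tv n) * b.1 (yv i) ^ 2
    = -(deriv (deriv μ) (b.1 (tv n)) / 8 * v.1 (tv n) * b.1 (yv i) ^ 2) := fun i => by ring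
  simp only [e1, e2, e3, e4, Pi.zero_apply, zero_mul, add_zero]
  ring

theorem pd_ansatz_u (hU : IsOpen U) (h : SmoothData (times U) τ μ F Fn) (hb : b ∈ U) (v : J0 n) :
    pd v (compU (ansatz τ μ c F Fn)) b =
      (deriv μ (b.1 (tv n)) - deriv (deriv τ) (b.1 (tv n))) * v.1 (xv n)
      + (deriv (deriv μ) (b.1 (tv n)) - deriv (deriv (deriv τ)) (b.1 (tv n)))
        * v.1 (tv n) * b.1 (xv n)
      - deriv (deriv (deriv μ)) (b.1 (tv n)) / 8 * v.1 (tv n) * ∑ i, b.1 (yv i) ^ 2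
      - deriv (deriv μ) (b.1 (tv n)) / 4 * ∑ i, b.1 (yv i) * v.1 (yv i)
      - v.1 (tv n) / 2 * ∑ i, deriv (deriv (deriv (F i))) (b.1 (tv n)) * b.1 (yv i)
      - 1 / 2 * ∑ i, deriv (deriv (F i)) (b.1 (tv n)) * v.1 (yv i)
      + deriv (deriv Fn) (b.1 (tv n)) * v.1 (tv n)
      + (μ (b.1 (tv n)) - 2 * deriv τ (b.1 (tv n))) * v.2
      + (deriv μ (b.1 (tv n)) - 2 * deriv (deriv τ) (b.1 (tv n))) * v.1 (tv n) * b.2 := by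
  have hI := isOpen_times hU
  have d : ∀ {f : ℝ → ℝ}, ContDiffOn ℝ ∞ f (times U) → ∀ t ∈ times U, HasDerivAt f (deriv f t) t :=
    fun hf t ht => hasDerivAt_of_smooth hI hf ht
  have s : ∀ {f : ℝ → ℝ}, ContDiffOn ℝ ∞ f (times U) → ContDiffOn ℝ ∞ (deriv f) (times U) :=
    fun hf => contDiffOn_deriv hI hf
  rw [compU_ansatz, pd_qf (a := fun t => deriv μ t - deriv (deriv τ) t)
    (m := fun t => -(deriv (deriv μ) t) / 8) (e := fun i t => -(deriv (deriv (F i)) t) / 2)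
    (r := fun t => μ t - 2 * deriv τ t)
    (a' := fun t => deriv (deriv μ) t - deriv (deriv (deriv τ)) t)
    (m' := fun t => -(deriv (deriv (deriv μ)) t) / 8)
    (e' := fun i t => -(deriv (deriv (deriv (F i))) t) / 2)
    (r' := fun t => deriv μ t - 2 * deriv (deriv τ) t)
    (fun t ht => (d (s h.mu) t ht).sub (d (s (s h.tau)) t ht))
    (fun t ht => (d (s (s h.mu)) t ht).neg.div_const 8)
    (fun i t ht => (d (s (s (h.F i))) t ht).neg.div_const 2) (d (s h.Fn))
    (fun t ht => (d h.mu t ht).sub ((d (s h.tau) t ht).const_mul 2)) hb]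
  simp only [qf, Finset.mul_sum, add_mul, Finset.sum_add_distrib, sub_eq_add_neg,
    ← Finset.sum_neg_distrib]
  have e1 : ∀ i : Fin (n - 1), 2 * (-deriv (deriv μ) (b.1 (tv n)) / 8) * v.1 (yv i) * b.1 (yv i)
    = -(deriv (deriv μ) (b.1 (tv n)) / 4 * (b.1 (yv i) * v.1 (yv i))) := fun i => by ring
  have e2 : ∀ i : Fin (n - 1),
      -deriv (deriv (deriv (F i))) (b.1 (tv n)) / 2 * v.1 (tv n) * b.1 (yv i)
    = -(v.1 (tv n) / 2 * (deriv (deriv (deriv (F i))) (b.1 (tv n)) * b.1 (yv i))) :=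
    fun i => by ring
  have e3 : ∀ i : Fin (n - 1), -deriv (deriv (F i)) (b.1 (tv n)) / 2 * v.1 (yv i)
    = -(1 / 2 * (deriv (deriv (F i)) (b.1 (tv n)) * v.1 (yv i))) := fun i => by ring
  have e4 : ∀ i : Fin (n - 1),
      -deriv (deriv (deriv μ)) (b.1 (tv n)) / 8 * v.1 (tv n) * b.1 (yv i) ^ 2
    = -(deriv (deriv (deriv μ)) (b.1 (tv n)) / 8 * v.1 (tv n) * b.1 (yv i) ^ 2) :=
    fun i => by ring
  simp only [e1, e2, e3, e4]
  ring

/-! ### The prolongation of the general first-order solution -/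

/-- The second derivatives of a component that enter `lowerPart`. -/
theorem pd_pd_qf (hU : IsOpen U) {a m k r : ℝ → ℝ} {e : Fin (n - 1) → ℝ → ℝ}
    (ha : ContDiffOn ℝ ∞ a (times U)) (hm : ContDiffOn ℝ ∞ m (times U))
    (he : ∀ i, ContDiffOn ℝ ∞ (e i) (times U)) (hk : ContDiffOn ℝ ∞ k (times U))
    (hr : ContDiffOn ℝ ∞ r (times U)) (hb : b ∈ U) (q : Var n → ℝ) :
    pd (dirD q (xv n)) (pd (dirD q (tv n)) (qf a m e k r)) b
        = deriv a (b.1 (tv n)) + deriv r (b.1 (tv n)) * q (xv n) ∧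
      pd (dirD q (xv n)) (pd (dirD q (xv n)) (qf a m e k r)) b = 0 ∧
      ∀ i, pd (dirD q (yv i)) (pd (dirD q (yv i)) (qf a m e k r)) b = 2 * m (b.1 (tv n)) := by
  have hI := isOpen_times hU
  have d : ∀ {f : ℝ → ℝ}, ContDiffOn ℝ ∞ f (times U) → ∀ t ∈ times U, HasDerivAt f (deriv f t) t :=
    fun hf t ht => hasDerivAt_of_smooth hI hf ht
  have s : ∀ {f : ℝ → ℝ}, ContDiffOn ℝ ∞ f (times U) → ContDiffOn ℝ ∞ (deriv f) (times U) :=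
    fun hf => contDiffOn_deriv hI hf
  have key : ∀ v w : J0 n, w.1 (tv n) = 0 → pd w (pd v (qf a m e k r)) b
      = v.1 (tv n) * (deriv a (b.1 (tv n)) * w.1 (xv n) + deriv r (b.1 (tv n)) * w.2)
        + 2 * deriv m (b.1 (tv n)) * v.1 (tv n) * ∑ i, w.1 (yv i) * b.1 (yv i)
        + ∑ i, (deriv (e i) (b.1 (tv n)) * v.1 (tv n) + 2 * m (b.1 (tv n)) * v.1 (yv i))
          * w.1 (yv i) := by
    intro v w hw
    have e1 : Set.EqOn (pd v (qf a m e k r)) _ U := fun b hb =>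
      pd_qf (d ha) (d hm) (fun i => d (he i)) (d hk) (d hr) hb v
    have hsum : ContDiffOn ℝ ∞ (fun t => a t * v.1 (xv n) + ∑ i, e i t * v.1 (yv i)
        + deriv k t * v.1 (tv n) + r t * v.2) (times U) :=
      (((ha.mul contDiffOn_const).add (ContDiffOn.sum fun i _ => (he i).mul contDiffOn_const)).add
        ((s hk).mul contDiffOn_const)).add (hr.mul contDiffOn_const)
    rw [pd_congr hU e1 w hb, pd_qf (d ((s ha).mul contDiffOn_const))
      (d ((s hm).mul contDiffOn_const))
      (fun i => d (((s (he i)).mul contDiffOn_const).add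
        ((contDiffOn_const.mul hm).mul contDiffOn_const))) (d hsum)
      (d ((s hr).mul contDiffOn_const)) hb]
    have e2 : ∀ i : Fin (n - 1), 2 * (deriv m (b.1 (tv n)) * v.1 (tv n)) * w.1 (yv i) * b.1 (yv i)
        = 2 * deriv m (b.1 (tv n)) * v.1 (tv n) * (w.1 (yv i) * b.1 (yv i)) := fun i => by ring
    simp only [qf, hw, mul_zero, zero_mul, zero_add, add_zero, e2,
      ← Finset.mul_sum]
    ring
  refine ⟨?_, ?_, fun i => ?_⟩
  · rw [key _ _ (by simp [dirD])]
    simp [dirD]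
  · rw [key _ _ (by simp [dirD])]
    simp [dirD]
  · rw [key _ _ (by simp [dirD])]
    simp [dirD, Pi.single_apply]

end

section

variable {n : ℕ} {U : Set (J0 n)} {b : J0 n} {τ μ : ℝ → ℝ}
  {c : Matrix (Fin (n - 1)) (Fin (n - 1)) ℝ} {F : Fin (n - 1) → ℝ → ℝ} {Fn : ℝ → ℝ}

theorem sum_mul_antisymm {ι : Type*} [Fintype ι] {S c : ι → ι → ℝ} (hS : ∀ i j, S i j = S j i)
    (hc : ∀ i j, c i j = -c j i) : ∑ i, ∑ j, S i j * c i j = 0 := by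
  have h : ∑ i, ∑ j, S i j * c i j = -∑ i, ∑ j, S i j * c i j := by
    conv_lhs => rw [Finset.sum_comm]
    rw [← Finset.sum_neg_distrib]
    refine Finset.sum_congr rfl fun i _ => ?_
    rw [← Finset.sum_neg_distrib]
    exact Finset.sum_congr rfl fun j _ => by rw [hS j i, hc j i]; ring
  linarith

theorem sum_var (g : Var n → ℝ) : ∑ k, g k = g (tv n) + g (xv n) + ∑ i, g (yv i) := by
  simp [Fintype.sum_sum_type, Fin.sum_univ_two]

theorem char2_ansatz (hU : IsOpen U) (h : SmoothData (times U) τ μ F Fn) (hb : b ∈ U)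
    (q : Var n → ℝ) :
    char2 (ansatz τ μ c F Fn) b q (dirD q (xv n)) (dirD q (tv n))
      = deriv (deriv μ) (b.1 (tv n)) - deriv (deriv (deriv τ)) (b.1 (tv n))
        - q (xv n) * deriv (deriv τ) (b.1 (tv n)) ∧
    char2 (ansatz τ μ c F Fn) b q (dirD q (xv n)) (dirD q (xv n)) = 0 ∧
    ∀ i, char2 (ansatz τ μ c F Fn) b q (dirD q (yv i)) (dirD q (yv i))
      = -(deriv (deriv μ) (b.1 (tv n))) / 4 + q (xv n) * deriv μ (b.1 (tv n)) / 4 := by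
  have hI := isOpen_times hU
  have ht := mem_times hb
  have d : ∀ {f : ℝ → ℝ}, ContDiffOn ℝ ∞ f (times U) →
      HasDerivAt f (deriv f (b.1 (tv n))) (b.1 (tv n)) :=
    fun hf => hasDerivAt_of_smooth hI hf ht
  have s : ∀ {f : ℝ → ℝ}, ContDiffOn ℝ ∞ f (times U) → ContDiffOn ℝ ∞ (deriv f) (times U) :=
    fun hf => contDiffOn_deriv hI hf
  have z : ContDiffOn ℝ ∞ (0 : ℝ → ℝ) (times U) := contDiffOn_const
  have hT := pd_pd_qf (n := n) hU (e := 0) z z (fun _ => z) h.tau z hb q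
  have hX := pd_pd_qf (n := n) hU (h.mu.sub (s h.tau)) ((s h.mu).neg.div_const 8)
    (fun i => (s (h.F i)).neg.div_const 2) h.Fn z hb q
  have hY := fun i => pd_pd_qf (n := n) hU z z
    (fun j => contDiffOn_ite h.mu (i = j) (c i j)) (h.F i) z hb q
  have hH := pd_pd_qf (n := n) hU ((s h.mu).sub (s (s h.tau))) ((s (s h.mu)).neg.div_const 8)
    (fun i => (s (s (h.F i))).neg.div_const 2) (s h.Fn)
    (h.mu.sub ((contDiffOn_const (c := (2 : ℝ))).mul (s h.tau))) hb q
  rw [← comp_ansatz_t (μ := μ) (c := c) (F := F) (Fn := Fn)] at hT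
  rw [← comp_ansatz_x (c := c)] at hX
  simp only [← comp_ansatz_y (τ := τ) (F := F) (Fn := Fn)] at hY
  rw [← compU_ansatz (c := c)] at hH
  have e1 : deriv (fun t => μ t - deriv τ t) (b.1 (tv n))
      = deriv μ (b.1 (tv n)) - deriv (deriv τ) (b.1 (tv n)) :=
    ((d h.mu).sub (d (s h.tau))).deriv
  have e2 : deriv (fun t => deriv μ t - deriv (deriv τ) t) (b.1 (tv n))
      = deriv (deriv μ) (b.1 (tv n)) - deriv (deriv (deriv τ)) (b.1 (tv n)) :=
    ((d (s h.mu)).sub (d (s (s h.tau)))).deriv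
  have e3 : deriv (fun t => μ t - 2 * deriv τ t) (b.1 (tv n))
      = deriv μ (b.1 (tv n)) - 2 * deriv (deriv τ) (b.1 (tv n)) :=
    ((d h.mu).sub ((d (s h.tau)).const_mul 2)).deriv
  rw [e1] at hX
  rw [e2, e3] at hH
  refine ⟨?_, ?_, fun i => ?_⟩
  · simp only [char2, sum_var, hT.1, hX.1, hH.1, fun i => (hY i).1]
    simp
    ring
  · simp only [char2, sum_var, hT.2.1, hX.2.1, hH.2.1, fun i => (hY i).2.1]
    simp
  · simp only [char2, sum_var, hT.2.2, hX.2.2, hH.2.2, fun j => (hY j).2.2]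
    simp
    ring

theorem lowerPart_ansatz (hn : 2 < n) (hU : IsOpen U) (h : SmoothData (times U) τ μ F Fn)
    (hb : b ∈ U) (q : Var n → ℝ) :
    lowerPart (ansatz τ μ c F Fn) b q
      = q (xv n) * ((n + 7) / 4 * deriv μ (b.1 (tv n)) - 3 * deriv (deriv τ) (b.1 (tv n)))
        + ((5 - n) / 4 * deriv (deriv μ) (b.1 (tv n)) - deriv (deriv (deriv τ)) (b.1 (tv n)))
        - 2 * deriv τ (b.1 (tv n)) * q (xv n) ^ 2 := by
  obtain ⟨h1, h2, h3⟩ := char2_ansatz (c := c) hU h hb q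
  have hcast : ((n - 1 : ℕ) : ℝ) = n - 1 := by
    rw [Nat.cast_sub (by omega)]; simp
  simp only [lowerPart, h1, h2, h3, char1, sum_var, pd_ansatz_t hU h hb, pd_ansatz_x hU h hb,
    pd_ansatz_y hU h hb, pd_ansatz_u hU h hb]
  simp [dirD, hcast]
  ring

theorem compU_ansatz_apply (b : J0 n) : compU (ansatz τ μ c F Fn) b =
    (deriv μ (b.1 (tv n)) - deriv (deriv τ) (b.1 (tv n))) * b.1 (xv n)
      - deriv (deriv μ) (b.1 (tv n)) / 8 * ∑ i, b.1 (yv i) ^ 2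
      - 1 / 2 * ∑ i, deriv (deriv (F i)) (b.1 (tv n)) * b.1 (yv i)
      + deriv Fn (b.1 (tv n)) + (μ (b.1 (tv n)) - 2 * deriv τ (b.1 (tv n))) * b.2 := by
  rw [compU_ansatz]
  have e : ∀ i : Fin (n - 1), -deriv (deriv (F i)) (b.1 (tv n)) / 2 * b.1 (yv i)
      = -1 / 2 * (deriv (deriv (F i)) (b.1 (tv n)) * b.1 (yv i)) := fun i => by ring
  simp only [qf, e, ← Finset.mul_sum]
  ring

/-- On the general first-order solution the prolongation acts on `E` as a multiple of `E`, up to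
the expressions whose vanishing is the remaining pair of differential equations for `τ`, `μ`. -/
theorem fderiv_E_prolong2_ansatz (hn : 2 < n) (hU : IsOpen U)
    (h : SmoothData (times U) τ μ F Fn) (hc : ∀ i j, c i j = -c j i) (s : J2 n)
    (hs : s.1.1 ∈ U) (hsym : ∀ i j, s.2 i j = s.2 j i) :
    fderiv ℝ (E n) s (prolong2 (ansatz τ μ c F Fn) s) =
      -2 * deriv τ (s.1.1.1 (tv n)) * E n s
      + s.1.2 (xv n) * ((n + 7) / 4 * deriv μ (s.1.1.1 (tv n))
        - 3 * deriv (deriv τ) (s.1.1.1 (tv n)))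
      + ((5 - n) / 4 * deriv (deriv μ) (s.1.1.1 (tv n))
        - deriv (deriv (deriv τ)) (s.1.1.1 (tv n))) := by
  rw [fderiv_E_prolong2 hU (contDiffOn_ansatz hU h) s hs, lowerPart_ansatz hn hU h hs,
    compU_ansatz_apply]
  obtain ⟨⟨b, q⟩, S⟩ := s
  simp only at hs hsym ⊢
  set t := b.1 (tv n) with htdef
  have hanti := sum_mul_antisymm (S := fun i j => S (yv i) (yv j))
    (c := fun i j => c i j) (fun i j => hsym _ _) hc
  have a1 : ∀ i : Fin (n - 1), totComp (ansatz τ μ c F Fn) b q (tv n) (yv i)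
      = deriv μ t / 2 * b.1 (yv i) + deriv (F i) t := fun i => by
    rw [totComp, pd_ansatz_y hU h hs]; simp [dirD, t]
  have a2 : ∀ i : Fin (n - 1), totComp (ansatz τ μ c F Fn) b q (xv n) (yv i) = 0 := fun i => by
    rw [totComp, pd_ansatz_y hU h hs]; simp [dirD]
  have a3 : ∀ i j : Fin (n - 1), totComp (ansatz τ μ c F Fn) b q (yv j) (yv i)
      = μ t / 2 * (if i = j then 1 else 0) + c i j := fun i j => by
    rw [totComp, pd_ansatz_y hU h hs]; simp [dirD, t, Pi.single_apply]
  have a4 : ∀ k, totComp (ansatz τ μ c F Fn) b q k (tv n)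
      = if k = tv n then deriv τ t else 0 := fun k => by
    rw [totComp, pd_ansatz_t hU h hs]; simp [dirD, t, Pi.single_apply, eq_comm]
  have a5 : ∀ i : Fin (n - 1), totComp (ansatz τ μ c F Fn) b q (yv i) (xv n)
      = -1 / 2 * (deriv μ t / 2 * b.1 (yv i) + deriv (F i) t) := fun i => by
    rw [totComp, pd_ansatz_x hU h hs]; simp [dirD, t, Pi.single_apply]; ring
  have a6 : totComp (ansatz τ μ c F Fn) b q (xv n) (xv n) = μ t - deriv τ t := by
    rw [totComp, pd_ansatz_x hU h hs]; simp [dirD, t]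
  have a7 : totComp (ansatz τ μ c F Fn) b q (tv n) (xv n)
      = (deriv μ t - deriv (deriv τ) t) * b.1 (xv n)
      - deriv (deriv μ) t / 8 * ∑ i, b.1 (yv i) ^ 2
      - 1 / 2 * ∑ i, deriv (deriv (F i)) t * b.1 (yv i) + deriv Fn t := by
    rw [totComp, pd_ansatz_x hU h hs]; simp [dirD, t]
  have a8 : char1 (ansatz τ μ c F Fn) b q (dirU n) = μ t - 2 * deriv τ t := by
    simp only [char1, sum_var, pd_ansatz_t hU h hs, pd_ansatz_x hU h hs, pd_ansatz_y hU h hs,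
      pd_ansatz_u hU h hs]
    simp [dirU, t]
  have s1 : ∑ i : Fin (n - 1), ∑ j : Fin (n - 1), (S (yv j) (yv i) + S (yv i) (yv j))
      * (μ t / 2 * (if j = i then 1 else 0) + c j i) = μ t * ∑ i : Fin (n - 1), S (yv i) (yv i) := by
    have e : ∀ i j : Fin (n - 1), (S (yv j) (yv i) + S (yv i) (yv j))
        * (μ t / 2 * (if j = i then 1 else 0) + c j i)
        = (if j = i then μ t * S (yv i) (yv i) else 0) - 2 * (S (yv i) (yv j) * c i j) := by
      intro i j
      rw [hsym (yv j) (yv i), hc j i]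
      split_ifs with hij
      · subst hij; ring
      · ring
    simp only [e, Finset.sum_sub_distrib, ← Finset.mul_sum, hanti]
    simp [Finset.mul_sum]
  have s2 : ∑ i : Fin (n - 1), (S (yv i) (xv n) * (deriv μ t / 2 * b.1 (yv i) + deriv (F i) t))
      + ∑ i : Fin (n - 1), (S (xv n) (yv i) + S (yv i) (xv n))
        * (-1 / 2 * (deriv μ t / 2 * b.1 (yv i) + deriv (F i) t)) = 0 := by
    rw [← Finset.sum_add_distrib]
    refine Finset.sum_eq_zero fun i _ => ?_
    rw [hsym (xv n) (yv i)]
    ring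
  simp only [sum_var, a1, a2, a3, a4, a5, a6, a7, a8, Finset.sum_add_distrib, s1, E]
  simp only [if_true, reduceCtorEq, if_false, mul_zero, Finset.sum_const_zero]
  have hxt : ¬ xv n = tv n := by simp
  simp only [hsym (xv n) (tv n), hxt, if_false]
  linear_combination -s2

theorem IsLieSymmetry.congr {X Y : J0 n → J0 n} (hU : IsOpen U) (hX : IsLieSymmetry n U X)
    (h : Set.EqOn Y X U) : IsLieSymmetry n U Y := by
  have hY : ContDiffOn ℝ ∞ Y U := hX.1.congr h
  have hc : ∀ k, Set.EqOn (comp Y k) (comp X k) U := fun k b hb => by simp only [comp, h hb]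
  have hu : Set.EqOn (compU Y) (compU X) U := fun b hb => by simp only [compU, h hb]
  refine ⟨hY, fun s hs hsym hE => ?_⟩
  rw [← hX.2 s hs hsym hE, fderiv_E_prolong2 hU hY s hs, fderiv_E_prolong2 hU hX.1 s hs]
  have e1 : ∀ q v, char1 Y s.1.1 q v = char1 X s.1.1 q v := fun q v => by
    simp only [char1, pd_congr hU hu v hs, fun k => pd_congr hU (hc k) v hs]
  have e2 : ∀ q v w, char2 Y s.1.1 q v w = char2 X s.1.1 q v w := fun q v w => by
    simp only [char2, pd_congr hU (pd_congr hU hu w) v hs,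
      fun k => pd_congr hU (pd_congr hU (hc k) w) v hs]
  have e3 : ∀ q i k, totComp Y s.1.1 q i k = totComp X s.1.1 q i k := fun q i k => by
    simp only [totComp, pd_congr hU (hc k) _ hs]
  simp only [lowerPart, e1, e2, e3, hu hs]

/-! ### The equations for the coefficients of time -/

/-- A solution of the first-order equations is a symmetry if and only if `τ` and `μ` solve a pair
of ordinary differential equations. -/
theorem isLieSymmetry_ansatz_iff (hn : 2 < n) (hU : IsOpen U)
    (h : SmoothData (times U) τ μ F Fn) (hc : ∀ i j, c i j = -c j i) :
    IsLieSymmetry n U (ansatz τ μ c F Fn) ↔ ∀ t ∈ times U,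
      (n + 7) / 4 * deriv μ t = 3 * deriv (deriv τ) t ∧
      (5 - n) / 4 * deriv (deriv μ) t = deriv (deriv (deriv τ)) t := by
  constructor
  · rintro hX _ ⟨b, hb, rfl⟩
    -- the equation at the first jet with `u_x = p` whose other first derivatives vanish
    have key : ∀ p : ℝ, p * ((n + 7) / 4 * deriv μ (b.1 (tv n))
        - 3 * deriv (deriv τ) (b.1 (tv n))) + ((5 - n) / 4 * deriv (deriv μ) (b.1 (tv n))
        - deriv (deriv (deriv τ)) (b.1 (tv n))) = 0 := by
      intro p
      have h1 := fun q : Var n → ℝ => hX.base hU hb q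
      have h2 := h1 (Pi.single (xv n) p)
      have a6 : ∀ q, totComp (ansatz τ μ c F Fn) b q (xv n) (xv n)
          = μ (b.1 (tv n)) - deriv τ (b.1 (tv n)) := fun q => by
        rw [totComp, pd_ansatz_x hU h hb]; simp [dirD]
      have a4 : ∀ q, totComp (ansatz τ μ c F Fn) b q (tv n) (tv n) = deriv τ (b.1 (tv n)) :=
        fun q => by rw [totComp, pd_ansatz_t hU h hb]; simp [dirD]
      have a8 : ∀ q, char1 (ansatz τ μ c F Fn) b q (dirU n)
          = μ (b.1 (tv n)) - 2 * deriv τ (b.1 (tv n)) := fun q => by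
        simp only [char1, sum_var, pd_ansatz_t hU h hb, pd_ansatz_x hU h hb, pd_ansatz_y hU h hb,
          pd_ansatz_u hU h hb]
        simp [dirU]
      rw [lowerPart_ansatz hn hU h hb, hX.totComp_xt hU hb, a6, a4, a8] at h2
      simp at h2
      linear_combination h2
    have k0 := key 0
    have k1 := key 1
    constructor <;> linarith
  · intro hode
    refine ⟨contDiffOn_ansatz hU h, fun s hs hsym hE => ?_⟩
    rw [fderiv_E_prolong2_ansatz hn hU h hc s hs hsym, hE]
    obtain ⟨h1, h2⟩ := hode _ (mem_times hs)
    rw [h1, h2]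
    ring

theorem eqOn_deriv {I : Set ℝ} (hI : IsOpen I) {f g : ℝ → ℝ} (h : Set.EqOn f g I) :
    Set.EqOn (deriv f) (deriv g) I := fun _ ht =>
  (h.eventuallyEq_of_mem (hI.mem_nhds ht)).deriv_eq

theorem eqOn_deriv_of_hasDerivAt {I : Set ℝ} (hI : IsOpen I) {f g f' : ℝ → ℝ}
    (h : Set.EqOn f g I) (hg : ∀ t ∈ I, HasDerivAt g (f' t) t) : Set.EqOn (deriv f) f' I :=
  fun t ht => (eqOn_deriv hI h ht).trans (hg t ht).deriv

/-- The differential equations for `τ` and `μ` force `τ''' = 0` when `n ≠ 2`. -/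
theorem exists_of_ode (hn : 2 < n) {I : Set ℝ} (hI : IsOpen I) (hIc : Convex ℝ I)
    (hτ : ContDiffOn ℝ ∞ τ I) (hμ : ContDiffOn ℝ ∞ μ I)
    (h : ∀ t ∈ I, (n + 7) / 4 * deriv μ t = 3 * deriv (deriv τ) t ∧
      (5 - n) / 4 * deriv (deriv μ) t = deriv (deriv (deriv τ)) t) :
    ∃ τ0 τ1 τ2 σ : ℝ, (∀ t ∈ I, τ t = τ2 * t ^ 2 + τ1 * t + τ0) ∧
      ∀ t ∈ I, μ t = 24 * τ2 / (n + 7) * t + 2 * σ := by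
  have hn7 : ((n : ℝ) + 7) ≠ 0 := by positivity
  have hn2 : (2 : ℝ) < n := by exact_mod_cast hn
  have d : ∀ {f : ℝ → ℝ}, ContDiffOn ℝ ∞ f I → ∀ t ∈ I, HasDerivAt f (deriv f t) t :=
    fun hf t ht => hasDerivAt_of_smooth hI hf ht
  have s : ∀ {f : ℝ → ℝ}, ContDiffOn ℝ ∞ f I → ContDiffOn ℝ ∞ (deriv f) I :=
    fun hf => contDiffOn_deriv hI hf
  have hμ' : Set.EqOn (deriv μ) (fun t => 12 / (n + 7) * deriv (deriv τ) t) I := fun t ht => by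
    have := (h t ht).1
    simp only
    field_simp
    linarith
  have hμ'' := eqOn_deriv_of_hasDerivAt hI hμ' fun t ht =>
    (d (s (s hτ)) t ht).const_mul (12 / ((n : ℝ) + 7))
  have hτ3 : ∀ t ∈ I, deriv (deriv (deriv τ)) t = 0 := by
    intro t ht
    have h2 := (h t ht).2
    rw [hμ'' ht] at h2
    field_simp at h2
    have : (32 - 16 * (n : ℝ)) * deriv (deriv (deriv τ)) t = 0 := by linear_combination h2
    rcases mul_eq_zero.1 this with h3 | h3
    · linarith
    · exact h3
  obtain ⟨c2, h2⟩ := exists_eq_const hI hIc (s (s hτ)) hτ3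
  obtain ⟨τ1, h1⟩ := exists_eq_const hI hIc
    (f := fun t => deriv τ t - c2 * t) ((s hτ).sub (contDiffOn_const.mul contDiffOn_id))
    fun t ht => by
      have := ((d (s hτ) t ht).sub ((hasDerivAt_id t).const_mul c2)).deriv
      simp only [h2 t ht, mul_one, sub_self] at this
      exact this
  obtain ⟨τ0, h0⟩ := exists_eq_const hI hIc
    (f := fun t => τ t - (c2 / 2 * t ^ 2 + τ1 * t))
    (hτ.sub ((contDiffOn_const.mul (contDiffOn_id.pow 2)).add
      (contDiffOn_const.mul contDiffOn_id)))
    fun t ht => by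
      have := ((d hτ t ht).sub ((((hasDerivAt_id t).pow 2).const_mul (c2 / 2)).add
        ((hasDerivAt_id t).const_mul τ1))).deriv
      refine (Eq.trans ?_ this).trans ?_
      · rfl
      · have := h1 t ht
        simp at this ⊢
        linarith
  obtain ⟨σ, hσ⟩ := exists_eq_const hI hIc
    (f := fun t => μ t - 12 * c2 / (n + 7) * t)
    (hμ.sub (contDiffOn_const.mul contDiffOn_id)) fun t ht => by
      have := ((d hμ t ht).sub ((hasDerivAt_id t).const_mul (12 * c2 / ((n : ℝ) + 7)))).deriv
      rw [hμ' ht] at this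
      simp only [h2 t ht] at this
      refine Eq.trans this ?_
      ring
  refine ⟨τ0, τ1, c2 / 2, σ / 2, fun t ht => ?_, fun t ht => ?_⟩
  · have := h0 t ht
    linarith
  · have := hσ t ht
    rw [← this]
    ring

end

section

variable {n : ℕ} {U : Set (J0 n)} {b : J0 n} {τ μ : ℝ → ℝ}
  {c : Matrix (Fin (n - 1)) (Fin (n - 1)) ℝ} {F : Fin (n - 1) → ℝ → ℝ} {Fn : ℝ → ℝ}

/-! ### The general symmetry -/

theorem ansatz_congr (hU : IsOpen U) {τ' μ' : ℝ → ℝ} {F' : Fin (n - 1) → ℝ → ℝ} {Fn' : ℝ → ℝ}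
    (hτ : Set.EqOn τ τ' (times U)) (hμ : Set.EqOn μ μ' (times U))
    (hF : ∀ i, Set.EqOn (F i) (F' i) (times U)) (hFn : Set.EqOn Fn Fn' (times U)) :
    Set.EqOn (ansatz τ μ c F Fn) (ansatz τ' μ' c F' Fn') U := by
  intro b hb
  have hI := isOpen_times hU
  have ht := mem_times hb
  have d : ∀ {f g : ℝ → ℝ}, Set.EqOn f g (times U) → Set.EqOn (deriv f) (deriv g) (times U) :=
    fun h => eqOn_deriv hI h
  simp only [ansatz, qf, hτ ht, hμ ht, fun i => hF i ht, hFn ht, d hτ ht, d hμ ht,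
    fun i => d (hF i) ht, d hFn ht, d (d hτ) ht, d (d hμ) ht, fun i => d (d (hF i)) ht]

theorem deriv_quad (τ0 τ1 τ2 : ℝ) :
    deriv (fun t => τ2 * t ^ 2 + τ1 * t + τ0) = fun t => 2 * τ2 * t + τ1 := by
  funext t
  have h := ((((hasDerivAt_id t).pow 2).const_mul τ2).add
    ((hasDerivAt_id t).const_mul τ1)).add_const τ0
  refine Eq.trans h.deriv ?_
  simp
  ring

theorem deriv_affine (a k : ℝ) : deriv (fun t => a * t + k) = fun _ => a := by
  funext t
  have h := ((hasDerivAt_id t).const_mul a).add_const k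
  refine Eq.trans h.deriv ?_
  simp

theorem generalField_eq_ansatz (τ0 τ1 τ2 σ : ℝ) : generalField n τ0 τ1 τ2 σ c F Fn =
    ansatz (fun t => τ2 * t ^ 2 + τ1 * t + τ0) (fun t => 24 * τ2 / (n + 7) * t + 2 * σ) c F Fn := by
  have hn7 : ((n : ℝ) + 7) ≠ 0 := by positivity
  funext b
  have e1 : ∀ i : Fin (n - 1), -deriv (F i) (b.1 (tv n)) / 2 * b.1 (yv i)
      = -(1 / 2) * (deriv (F i) (b.1 (tv n)) * b.1 (yv i)) := fun i => by ring
  have e2 : ∀ i : Fin (n - 1), -deriv (deriv (F i)) (b.1 (tv n)) / 2 * b.1 (yv i)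
      = -(1 / 2) * (deriv (deriv (F i)) (b.1 (tv n)) * b.1 (yv i)) := fun i => by ring
  simp only [generalField, ansatz, qf, deriv_quad, deriv_affine, deriv_const, e1, e2,
    ← Finset.mul_sum]
  congr 1
  · field_simp
    simp
    ring
  · funext i
    field_simp
    ring
  · field_simp
    ring

theorem smoothData_general {I : Set ℝ} (τ0 τ1 τ2 σ : ℝ) (hF : ∀ i, ContDiffOn ℝ ∞ (F i) I)
    (hFn : ContDiffOn ℝ ∞ Fn I) : SmoothData I (fun t => τ2 * t ^ 2 + τ1 * t + τ0)
      (fun t => 24 * τ2 / (n + 7) * t + 2 * σ) F Fn where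
  tau := by fun_prop
  mu := by fun_prop
  F := hF
  Fn := hFn

theorem isLieSymmetry_iff (hn : 2 < n) (hU : IsOpen U) (hUc : Convex ℝ U) (hUne : U.Nonempty)
    (X : J0 n → J0 n) : IsLieSymmetry n U X ↔
      ∃ (τ0 τ1 τ2 σ : ℝ) (c : Matrix (Fin (n - 1)) (Fin (n - 1)) ℝ)
        (F : Fin (n - 1) → ℝ → ℝ) (Fn : ℝ → ℝ),
        (∀ i j, c i j = -c j i) ∧ (∀ i, ContDiffOn ℝ ∞ (F i) (times U)) ∧
        ContDiffOn ℝ ∞ Fn (times U) ∧ Set.EqOn X (generalField n τ0 τ1 τ2 σ c F Fn) U := by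
  have hI := isOpen_times hU
  constructor
  · intro hX
    obtain ⟨τ, μ, c, F, Fn, hc, hτ, hμ, hF, hFn, hXe⟩ :=
      (hX.firstOrder hn hU).exists_ansatz hn hU hUc hUne
    have hode := (isLieSymmetry_ansatz_iff hn hU ⟨hτ, hμ, hF, hFn⟩ hc).1 (hX.congr hU hXe.symm)
    obtain ⟨τ0, τ1, τ2, σ, h1, h2⟩ := exists_of_ode hn hI (convex_times hUc) hτ hμ hode
    refine ⟨τ0, τ1, τ2, σ, c, F, Fn, hc, hF, hFn, hXe.trans ?_⟩
    rw [generalField_eq_ansatz]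
    exact ansatz_congr hU h1 h2 (fun _ _ _ => rfl) fun _ _ => rfl
  · rintro ⟨τ0, τ1, τ2, σ, c, F, Fn, hc, hF, hFn, hXe⟩
    rw [generalField_eq_ansatz] at hXe
    refine IsLieSymmetry.congr hU ?_ hXe
    rw [isLieSymmetry_ansatz_iff hn hU (smoothData_general τ0 τ1 τ2 σ hF hFn) hc]
    have hn7 : ((n : ℝ) + 7) ≠ 0 := by positivity
    intro t _
    simp only [deriv_quad, deriv_affine, deriv_const]
    constructor
    · field_simp
      ring
    · simp

/-! ### The Lie bracket -/

theorem sum_skew {ι : Type*} [Fintype ι] {c : ι → ι → ℝ} (hc : ∀ i j, c i j = -c j i)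
    (y g : ι → ℝ) : ∑ i, y i * ∑ j, c i j * g j = -∑ i, g i * ∑ j, c i j * y j := by
  simp only [Finset.mul_sum, ← Finset.sum_neg_distrib]
  rw [Finset.sum_comm]
  exact Finset.sum_congr rfl fun i _ => Finset.sum_congr rfl fun j _ => by rw [hc j i]; ring

theorem sum_skew_self {ι : Type*} [Fintype ι] {c : ι → ι → ℝ} (hc : ∀ i j, c i j = -c j i)
    (y : ι → ℝ) : ∑ i, y i * ∑ j, c i j * y j = 0 := by
  linarith [sum_skew hc y y]

/-- The functions `F_i` of the bracket of two general fields. -/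
noncomputable def bracketF (τ μ : ℝ → ℝ) (c : Matrix (Fin (n - 1)) (Fin (n - 1)) ℝ)
    (F : Fin (n - 1) → ℝ → ℝ) (θ ν : ℝ → ℝ) (d : Matrix (Fin (n - 1)) (Fin (n - 1)) ℝ)
    (G : Fin (n - 1) → ℝ → ℝ) (i : Fin (n - 1)) (t : ℝ) : ℝ :=
  τ t * deriv (G i) t - θ t * deriv (F i) t + ν t / 2 * F i t - μ t / 2 * G i t
    + ((∑ j, d i j * F j t) - ∑ j, c i j * G j t)

/-- The function `F_n` of the bracket of two general fields. -/
noncomputable def bracketFn (τ μ : ℝ → ℝ) (F : Fin (n - 1) → ℝ → ℝ) (Fn : ℝ → ℝ) (θ ν : ℝ → ℝ)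
    (G : Fin (n - 1) → ℝ → ℝ) (Gn : ℝ → ℝ) (t : ℝ) : ℝ :=
  τ t * deriv Gn t - θ t * deriv Fn t + (ν t - deriv θ t) * Fn t - (μ t - deriv τ t) * Gn t
    - 1 / 2 * ((∑ j, deriv (G j) t * F j t) - ∑ j, deriv (F j) t * G j t)

theorem comp_lieBracket {X Y : J0 n → J0 n} (hX : DifferentiableAt ℝ X b)
    (hY : DifferentiableAt ℝ Y b) (k : Var n) : comp (VectorField.lieBracket ℝ X Y) k b
      = pd (X b) (comp Y k) b - pd (Y b) (comp X k) b := by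
  have key : ∀ {Z : J0 n → J0 n}, DifferentiableAt ℝ Z b → ∀ v, pd v (comp Z k) b
      = (fderiv ℝ Z b v).1 k := by
    intro Z hZ v
    have h := ((ContinuousLinearMap.proj (R := ℝ) (φ := fun _ : Var n => ℝ) k).comp
        (ContinuousLinearMap.fst ℝ (Var n → ℝ) ℝ)).hasFDerivAt.comp b hZ.hasFDerivAt
    exact congrArg (fun L : J0 n →L[ℝ] ℝ => L v) h.fderiv
  rw [key hX, key hY]
  rfl

theorem compU_lieBracket {X Y : J0 n → J0 n} (hX : DifferentiableAt ℝ X b)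
    (hY : DifferentiableAt ℝ Y b) : compU (VectorField.lieBracket ℝ X Y) b
      = pd (X b) (compU Y) b - pd (Y b) (compU X) b := by
  have key : ∀ {Z : J0 n → J0 n}, DifferentiableAt ℝ Z b → ∀ v, pd v (compU Z) b
      = (fderiv ℝ Z b v).2 := by
    intro Z hZ v
    have h := (ContinuousLinearMap.snd ℝ (Var n → ℝ) ℝ).hasFDerivAt.comp b hZ.hasFDerivAt
    exact congrArg (fun L : J0 n →L[ℝ] ℝ => L v) h.fderiv
  rw [key hX, key hY]
  rfl

section Bracket

variable {θ ν : ℝ → ℝ} {d : Matrix (Fin (n - 1)) (Fin (n - 1)) ℝ} {G : Fin (n - 1) → ℝ → ℝ}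
  {Gn : ℝ → ℝ}

theorem ansatz_apply_x (b : J0 n) : (ansatz τ μ c F Fn b).1 (xv n) =
    (μ (b.1 (tv n)) - deriv τ (b.1 (tv n))) * b.1 (xv n)
      - deriv μ (b.1 (tv n)) / 8 * ∑ i, b.1 (yv i) ^ 2
      - 1 / 2 * ∑ i, deriv (F i) (b.1 (tv n)) * b.1 (yv i) + Fn (b.1 (tv n)) := by
  change comp (ansatz τ μ c F Fn) (xv n) b = _
  rw [comp_ansatz_x]
  have e : ∀ i : Fin (n - 1), -deriv (F i) (b.1 (tv n)) / 2 * b.1 (yv i)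
      = -1 / 2 * (deriv (F i) (b.1 (tv n)) * b.1 (yv i)) := fun i => by ring
  simp only [qf, e, ← Finset.mul_sum, Pi.zero_apply]
  ring

theorem hasDerivAt_bracketF {I : Set ℝ} (hI : IsOpen I) (h1 : SmoothData I τ μ F Fn)
    (h2 : SmoothData I θ ν G Gn) (i : Fin (n - 1)) (t : ℝ) (ht : t ∈ I) :
    HasDerivAt (bracketF τ μ c F θ ν d G i)
      (deriv τ t * deriv (G i) t + τ t * deriv (deriv (G i)) t
        - (deriv θ t * deriv (F i) t + θ t * deriv (deriv (F i)) t)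
        + (deriv ν t / 2 * F i t + ν t / 2 * deriv (F i) t)
        - (deriv μ t / 2 * G i t + μ t / 2 * deriv (G i) t)
        + ((∑ j, d i j * deriv (F j) t) - ∑ j, c i j * deriv (G j) t)) t := by
  have D : ∀ {f : ℝ → ℝ}, ContDiffOn ℝ ∞ f I → HasDerivAt f (deriv f t) t :=
    fun hf => hasDerivAt_of_smooth hI hf ht
  have s : ∀ {f : ℝ → ℝ}, ContDiffOn ℝ ∞ f I → ContDiffOn ℝ ∞ (deriv f) I :=
    fun hf => contDiffOn_deriv hI hf
  exact (((((D h1.tau).mul (D (s (h2.F i)))).sub ((D h2.tau).mul (D (s (h1.F i))))).add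
    (((D h2.mu).div_const 2).mul (D (h1.F i)))).sub (((D h1.mu).div_const 2).mul (D (h2.F i)))).add
    ((HasDerivAt.fun_sum fun j _ => (D (h1.F j)).const_mul _).sub
      (HasDerivAt.fun_sum fun j _ => (D (h2.F j)).const_mul _))

theorem deriv_deriv_bracketF {I : Set ℝ} (hI : IsOpen I) (h1 : SmoothData I τ μ F Fn)
    (h2 : SmoothData I θ ν G Gn) (i : Fin (n - 1)) (t : ℝ) (ht : t ∈ I) :
    deriv (deriv (bracketF τ μ c F θ ν d G i)) t =
      deriv (deriv τ) t * deriv (G i) t + 2 * deriv τ t * deriv (deriv (G i)) t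
        + τ t * deriv (deriv (deriv (G i))) t
        - (deriv (deriv θ) t * deriv (F i) t + 2 * deriv θ t * deriv (deriv (F i)) t
          + θ t * deriv (deriv (deriv (F i))) t)
        + (deriv (deriv ν) t / 2 * F i t + deriv ν t * deriv (F i) t
          + ν t / 2 * deriv (deriv (F i)) t)
        - (deriv (deriv μ) t / 2 * G i t + deriv μ t * deriv (G i) t
          + μ t / 2 * deriv (deriv (G i)) t)
        + ((∑ j, d i j * deriv (deriv (F j)) t) - ∑ j, c i j * deriv (deriv (G j)) t) := by
  have D : ∀ {f : ℝ → ℝ}, ContDiffOn ℝ ∞ f I → HasDerivAt f (deriv f t) t :=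
    fun hf => hasDerivAt_of_smooth hI hf ht
  have s : ∀ {f : ℝ → ℝ}, ContDiffOn ℝ ∞ f I → ContDiffOn ℝ ∞ (deriv f) I :=
    fun hf => contDiffOn_deriv hI hf
  have e := eqOn_deriv hI (f := deriv (bracketF τ μ c F θ ν d G i)) fun t ht =>
    (hasDerivAt_bracketF (c := c) (d := d) hI h1 h2 i t ht).deriv
  rw [e ht]
  refine Eq.trans (((((((D (s h1.tau)).mul (D (s (h2.F i)))).add
    ((D h1.tau).mul (D (s (s (h2.F i)))))).sub
    (((D (s h2.tau)).mul (D (s (h1.F i)))).add ((D h2.tau).mul (D (s (s (h1.F i))))))).add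
    ((((D (s h2.mu)).div_const 2).mul (D (h1.F i))).add
      (((D h2.mu).div_const 2).mul (D (s (h1.F i)))))).sub
    ((((D (s h1.mu)).div_const 2).mul (D (h2.F i))).add
      (((D h1.mu).div_const 2).mul (D (s (h2.F i)))))).add
    ((HasDerivAt.fun_sum fun j _ => (D (s (h1.F j))).const_mul _).sub
      (HasDerivAt.fun_sum fun j _ => (D (s (h2.F j))).const_mul _))).deriv ?_
  ring

theorem deriv_bracketFn {I : Set ℝ} (hI : IsOpen I) (h1 : SmoothData I τ μ F Fn)
    (h2 : SmoothData I θ ν G Gn) (t : ℝ) (ht : t ∈ I) :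
    deriv (bracketFn τ μ F Fn θ ν G Gn) t =
      deriv τ t * deriv Gn t + τ t * deriv (deriv Gn) t
        - (deriv θ t * deriv Fn t + θ t * deriv (deriv Fn) t)
        + ((deriv ν t - deriv (deriv θ) t) * Fn t + (ν t - deriv θ t) * deriv Fn t)
        - ((deriv μ t - deriv (deriv τ) t) * Gn t + (μ t - deriv τ t) * deriv Gn t)
        - 1 / 2 * ((∑ j, deriv (deriv (G j)) t * F j t)
          - ∑ j, deriv (deriv (F j)) t * G j t) := by
  have D : ∀ {f : ℝ → ℝ}, ContDiffOn ℝ ∞ f I → HasDerivAt f (deriv f t) t :=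
    fun hf => hasDerivAt_of_smooth hI hf ht
  have s : ∀ {f : ℝ → ℝ}, ContDiffOn ℝ ∞ f I → ContDiffOn ℝ ∞ (deriv f) I :=
    fun hf => contDiffOn_deriv hI hf
  refine Eq.trans ((((((D h1.tau).mul (D (s h2.Fn))).sub ((D h2.tau).mul (D (s h1.Fn)))).add
    (((D h2.mu).sub (D (s h2.tau))).mul (D h1.Fn))).sub
    (((D h1.mu).sub (D (s h1.tau))).mul (D h2.Fn))).sub
    (((HasDerivAt.fun_sum fun j _ => (D (s (h2.F j))).mul (D (h1.F j))).sub
      (HasDerivAt.fun_sum fun j _ => (D (s (h1.F j))).mul (D (h2.F j)))).const_mul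
        (1 / 2 : ℝ))).deriv ?_
  have e : ∑ j, deriv (F j) t * deriv (G j) t = ∑ j, deriv (G j) t * deriv (F j) t :=
    Finset.sum_congr rfl fun j _ => mul_comm _ _
  simp only [Finset.sum_add_distrib, e, Pi.sub_apply]
  ring

/-- The general solutions of the first-order equations are closed under the Lie bracket. -/
theorem lieBracket_ansatz (hU : IsOpen U) (h1 : SmoothData (times U) τ μ F Fn)
    (h2 : SmoothData (times U) θ ν G Gn) (hc : ∀ i j, c i j = -c j i)
    (hd : ∀ i j, d i j = -d j i) :
    Set.EqOn (VectorField.lieBracket ℝ (ansatz τ μ c F Fn) (ansatz θ ν d G Gn))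
      (ansatz (fun t => τ t * deriv θ t - θ t * deriv τ t) (fun t => τ t * deriv ν t - θ t * deriv μ t)
        (d * c - c * d) (bracketF τ μ c F θ ν d G) (bracketFn τ μ F Fn θ ν G Gn)) U := by
  intro b hb
  have hI := isOpen_times hU
  have ht := mem_times hb
  have dX : DifferentiableAt ℝ (ansatz τ μ c F Fn) b :=
    ((contDiffOn_ansatz hU h1).contDiffAt (hU.mem_nhds hb)).differentiableAt (by simp)
  have dY : DifferentiableAt ℝ (ansatz θ ν d G Gn) b :=
    ((contDiffOn_ansatz hU h2).contDiffAt (hU.mem_nhds hb)).differentiableAt (by simp)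
  have D : ∀ {f : ℝ → ℝ}, ContDiffOn ℝ ∞ f (times U) → ∀ t ∈ times U, HasDerivAt f (deriv f t) t :=
    fun hf t ht => hasDerivAt_of_smooth hI hf ht
  have s : ∀ {f : ℝ → ℝ}, ContDiffOn ℝ ∞ f (times U) → ContDiffOn ℝ ∞ (deriv f) (times U) :=
    fun hf => contDiffOn_deriv hI hf
  -- first and second derivatives of the new `τ` and `μ`
  have t1 : ∀ t ∈ times U, HasDerivAt (fun t => τ t * deriv θ t - θ t * deriv τ t)
      (τ t * deriv (deriv θ) t - θ t * deriv (deriv τ) t) t := fun t ht => by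
    refine (((D h1.tau t ht).mul (D (s h2.tau) t ht)).sub
      ((D h2.tau t ht).mul (D (s h1.tau) t ht))).congr_deriv ?_
    ring
  have t2 : deriv (deriv fun t => τ t * deriv θ t - θ t * deriv τ t) (b.1 (tv n)) = _ :=
    (eqOn_deriv hI fun t ht => (t1 t ht).deriv) ht |>.trans
      (((D h1.tau _ ht).mul (D (s (s h2.tau)) _ ht)).sub
        ((D h2.tau _ ht).mul (D (s (s h1.tau)) _ ht))).deriv
  have m1 : ∀ t ∈ times U, HasDerivAt (fun t => τ t * deriv ν t - θ t * deriv μ t)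
      (deriv τ t * deriv ν t + τ t * deriv (deriv ν) t
        - (deriv θ t * deriv μ t + θ t * deriv (deriv μ) t)) t := fun t ht =>
    ((D h1.tau t ht).mul (D (s h2.mu) t ht)).sub ((D h2.tau t ht).mul (D (s h1.mu) t ht))
  have m2 : deriv (deriv fun t => τ t * deriv ν t - θ t * deriv μ t) (b.1 (tv n)) = _ :=
    (eqOn_deriv hI fun t ht => (m1 t ht).deriv) ht |>.trans
      ((((D (s h1.tau) _ ht).mul (D (s h2.mu) _ ht)).add
        ((D h1.tau _ ht).mul (D (s (s h2.mu)) _ ht))).sub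
        (((D (s h2.tau) _ ht).mul (D (s h1.mu) _ ht)).add
          ((D h2.tau _ ht).mul (D (s (s h1.mu)) _ ht)))).deriv
  have f1 := fun i => (hasDerivAt_bracketF (c := c) (d := d) hI h1 h2 i _ ht).deriv
  have f2 := fun i => deriv_deriv_bracketF (c := c) (d := d) hI h1 h2 i _ ht
  have fn1 := deriv_bracketFn hI h1 h2 _ ht
  -- components of the two fields
  have vt : ∀ {τ μ : ℝ → ℝ} {c : Matrix (Fin (n - 1)) (Fin (n - 1)) ℝ}
      {F : Fin (n - 1) → ℝ → ℝ} {Fn : ℝ → ℝ},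
      (ansatz τ μ c F Fn b).1 (tv n) = τ (b.1 (tv n)) := rfl
  have vy : ∀ {τ μ : ℝ → ℝ} {c : Matrix (Fin (n - 1)) (Fin (n - 1)) ℝ}
      {F : Fin (n - 1) → ℝ → ℝ} {Fn : ℝ → ℝ} (i), (ansatz τ μ c F Fn b).1 (yv i)
      = μ (b.1 (tv n)) / 2 * b.1 (yv i) + ∑ j, c i j * b.1 (yv j) + F i (b.1 (tv n)) :=
    fun _ => rfl
  have vu : ∀ {τ μ : ℝ → ℝ} {c : Matrix (Fin (n - 1)) (Fin (n - 1)) ℝ}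
      {F : Fin (n - 1) → ℝ → ℝ} {Fn : ℝ → ℝ}, (ansatz τ μ c F Fn b).2 = _ :=
    compU_ansatz_apply b
  set t := b.1 (tv n) with htdef
  -- sums over the transverse index
  have S1 : ∀ (μ : ℝ) (c : Fin (n - 1) → Fin (n - 1) → ℝ) (f : Fin (n - 1) → ℝ),
      (∀ i j, c i j = -c j i) → ∑ i : Fin (n - 1), b.1 (yv i)
        * (μ / 2 * b.1 (yv i) + ∑ j, c i j * b.1 (yv j) + f i)
      = μ / 2 * ∑ i : Fin (n - 1), b.1 (yv i) ^ 2 + ∑ i : Fin (n - 1), f i * b.1 (yv i) := by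
    intro μ c f hc
    have e : ∀ i : Fin (n - 1), b.1 (yv i) * (μ / 2 * b.1 (yv i) + ∑ j, c i j * b.1 (yv j) + f i)
        = μ / 2 * b.1 (yv i) ^ 2 + f i * b.1 (yv i) + b.1 (yv i) * ∑ j, c i j * b.1 (yv j) :=
      fun i => by ring
    simp only [e, Finset.sum_add_distrib, sum_skew_self hc, ← Finset.mul_sum, add_zero]
  have S2 : ∀ (μ : ℝ) (c : Fin (n - 1) → Fin (n - 1) → ℝ) (f g : Fin (n - 1) → ℝ),
      ∑ i : Fin (n - 1), g i * (μ / 2 * b.1 (yv i) + ∑ j, c i j * b.1 (yv j) + f i)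
      = μ / 2 * ∑ i : Fin (n - 1), g i * b.1 (yv i)
        + ∑ i : Fin (n - 1), g i * ∑ j, c i j * b.1 (yv j) + ∑ i : Fin (n - 1), g i * f i := by
    intro μ c f g
    have e : ∀ i : Fin (n - 1), g i * (μ / 2 * b.1 (yv i) + ∑ j, c i j * b.1 (yv j) + f i)
        = μ / 2 * (g i * b.1 (yv i)) + g i * (∑ j, c i j * b.1 (yv j)) + g i * f i :=
      fun i => by ring
    simp only [e, Finset.sum_add_distrib, ← Finset.mul_sum]
  refine Prod.ext (funext fun k => ?_) ?_
  · change comp _ k b = comp _ k b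
    rw [comp_lieBracket dX dY]
    rcases k with k | i
    · fin_cases k
      · change pd _ (comp _ (tv n)) b - pd _ (comp _ (tv n)) b = comp _ (tv n) b
        rw [pd_ansatz_t hU h1 hb, pd_ansatz_t hU h2 hb]
        simp only [comp, vt]
        ring
      · change pd _ (comp _ (xv n)) b - pd _ (comp _ (xv n)) b = comp _ (xv n) b
        rw [pd_ansatz_x hU h1 hb, pd_ansatz_x hU h2 hb]
        have H1 : ∑ i : Fin (n - 1), deriv (bracketF τ μ c F θ ν d G i) t * b.1 (yv i)
            = deriv τ t * ∑ i : Fin (n - 1), deriv (G i) t * b.1 (yv i)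
            + τ t * ∑ i : Fin (n - 1), deriv (deriv (G i)) t * b.1 (yv i)
            - deriv θ t * ∑ i : Fin (n - 1), deriv (F i) t * b.1 (yv i)
            - θ t * ∑ i : Fin (n - 1), deriv (deriv (F i)) t * b.1 (yv i)
            + deriv ν t / 2 * ∑ i : Fin (n - 1), F i t * b.1 (yv i)
            + ν t / 2 * ∑ i : Fin (n - 1), deriv (F i) t * b.1 (yv i)
            - deriv μ t / 2 * ∑ i : Fin (n - 1), G i t * b.1 (yv i)
            - μ t / 2 * ∑ i : Fin (n - 1), deriv (G i) t * b.1 (yv i)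
            - ∑ i, deriv (F i) t * ∑ j, d i j * b.1 (yv j)
            + ∑ i, deriv (G i) t * ∑ j, c i j * b.1 (yv j) := by
          have e : ∀ i : Fin (n - 1), deriv (bracketF τ μ c F θ ν d G i) t * b.1 (yv i)
              = deriv τ t * (deriv (G i) t * b.1 (yv i))
              + τ t * (deriv (deriv (G i)) t * b.1 (yv i))
              - deriv θ t * (deriv (F i) t * b.1 (yv i))
              - θ t * (deriv (deriv (F i)) t * b.1 (yv i))
              + deriv ν t / 2 * (F i t * b.1 (yv i)) + ν t / 2 * (deriv (F i) t * b.1 (yv i))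
              - deriv μ t / 2 * (G i t * b.1 (yv i)) - μ t / 2 * (deriv (G i) t * b.1 (yv i))
              + b.1 (yv i) * (∑ j, d i j * deriv (F j) t)
              - b.1 (yv i) * (∑ j, c i j * deriv (G j) t) := fun i => by rw [f1 i]; ring
          rw [Finset.sum_congr rfl fun i _ => e i]
          simp only [Finset.sum_add_distrib, Finset.sum_sub_distrib, ← Finset.mul_sum]
          rw [sum_skew hd, sum_skew hc]
          ring
        simp only [ansatz_apply_x, comp, vt, vy, S1 _ c _ hc, S1 _ d _ hd, S2 _ c, S2 _ d, ← htdef, H1,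
          (t1 t ht).deriv, (m1 t ht).deriv, bracketFn]
        ring
    · rw [pd_ansatz_y hU h1 hb, pd_ansatz_y hU h2 hb]
      simp only [comp, vt, vy, ← htdef, bracketF]
      have M : ∀ (c d : Matrix (Fin (n - 1)) (Fin (n - 1)) ℝ) (μ : ℝ) (f : Fin (n - 1) → ℝ),
          ∑ j, d i j * (μ / 2 * b.1 (yv j) + ∑ k, c j k * b.1 (yv k) + f j)
          = μ / 2 * ∑ j, d i j * b.1 (yv j) + ∑ k, (d * c) i k * b.1 (yv k)
            + ∑ j, d i j * f j := by
        intro c d μ f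
        refine (S2 μ c f (d i)).trans ?_
        congr 2
        simp only [Matrix.mul_apply, Finset.sum_mul, Finset.mul_sum]
        rw [Finset.sum_comm]
        exact Finset.sum_congr rfl fun k _ => Finset.sum_congr rfl fun j _ => by ring
      rw [M, M]
      simp only [Matrix.sub_apply, sub_mul, Finset.sum_sub_distrib]
      ring
  · change compU _ b = compU _ b
    rw [compU_lieBracket dX dY, pd_ansatz_u hU h1 hb, pd_ansatz_u hU h2 hb, compU_ansatz_apply]
    have H2 : ∑ i : Fin (n - 1), deriv (deriv (bracketF τ μ c F θ ν d G i)) t * b.1 (yv i)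
        = deriv (deriv τ) t * ∑ i : Fin (n - 1), deriv (G i) t * b.1 (yv i)
        + 2 * deriv τ t * ∑ i : Fin (n - 1), deriv (deriv (G i)) t * b.1 (yv i)
        + τ t * ∑ i : Fin (n - 1), deriv (deriv (deriv (G i))) t * b.1 (yv i)
        - deriv (deriv θ) t * ∑ i : Fin (n - 1), deriv (F i) t * b.1 (yv i)
        - 2 * deriv θ t * ∑ i : Fin (n - 1), deriv (deriv (F i)) t * b.1 (yv i)
        - θ t * ∑ i : Fin (n - 1), deriv (deriv (deriv (F i))) t * b.1 (yv i)
        + deriv (deriv ν) t / 2 * ∑ i : Fin (n - 1), F i t * b.1 (yv i)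
        + deriv ν t * ∑ i : Fin (n - 1), deriv (F i) t * b.1 (yv i)
        + ν t / 2 * ∑ i : Fin (n - 1), deriv (deriv (F i)) t * b.1 (yv i)
        - deriv (deriv μ) t / 2 * ∑ i : Fin (n - 1), G i t * b.1 (yv i)
        - deriv μ t * ∑ i : Fin (n - 1), deriv (G i) t * b.1 (yv i)
        - μ t / 2 * ∑ i : Fin (n - 1), deriv (deriv (G i)) t * b.1 (yv i)
        - ∑ i, deriv (deriv (F i)) t * ∑ j, d i j * b.1 (yv j)
        + ∑ i, deriv (deriv (G i)) t * ∑ j, c i j * b.1 (yv j) := by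
      have e : ∀ i : Fin (n - 1), deriv (deriv (bracketF τ μ c F θ ν d G i)) t * b.1 (yv i)
          = deriv (deriv τ) t * (deriv (G i) t * b.1 (yv i))
          + 2 * deriv τ t * (deriv (deriv (G i)) t * b.1 (yv i))
          + τ t * (deriv (deriv (deriv (G i))) t * b.1 (yv i))
          - deriv (deriv θ) t * (deriv (F i) t * b.1 (yv i))
          - 2 * deriv θ t * (deriv (deriv (F i)) t * b.1 (yv i))
          - θ t * (deriv (deriv (deriv (F i))) t * b.1 (yv i))
          + deriv (deriv ν) t / 2 * (F i t * b.1 (yv i))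
          + deriv ν t * (deriv (F i) t * b.1 (yv i))
          + ν t / 2 * (deriv (deriv (F i)) t * b.1 (yv i))
          - deriv (deriv μ) t / 2 * (G i t * b.1 (yv i))
          - deriv μ t * (deriv (G i) t * b.1 (yv i))
          - μ t / 2 * (deriv (deriv (G i)) t * b.1 (yv i))
          + b.1 (yv i) * (∑ j, d i j * deriv (deriv (F j)) t)
          - b.1 (yv i) * (∑ j, c i j * deriv (deriv (G j)) t) := fun i => by rw [f2 i]; ring
      rw [Finset.sum_congr rfl fun i _ => e i]
      simp only [Finset.sum_add_distrib, Finset.sum_sub_distrib, ← Finset.mul_sum]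
      rw [sum_skew hd, sum_skew hc]
      ring
    simp only [ansatz_apply_x, vu, vt, vy, S1 _ c _ hc, S1 _ d _ hd, S2 _ c, S2 _ d, ← htdef, H2,
      (t1 t ht).deriv, (m1 t ht).deriv, t2, m2, fn1]
    ring

end Bracket

end

section

variable {n : ℕ} {U : Set (J0 n)}

/-- The symmetries are closed under the Lie bracket. -/
theorem IsLieSymmetry.lieBracket (hn : 2 < n) (hU : IsOpen U) (hUc : Convex ℝ U)
    (hUne : U.Nonempty) {X Y : J0 n → J0 n} (hX : IsLieSymmetry n U X)
    (hY : IsLieSymmetry n U Y) : IsLieSymmetry n U (VectorField.lieBracket ℝ X Y) := by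
  have hI := isOpen_times hU
  have hn7 : ((n : ℝ) + 7) ≠ 0 := by positivity
  rw [isLieSymmetry_iff hn hU hUc hUne] at hX hY ⊢
  obtain ⟨τ0, τ1, τ2, σ, c, F, Fn, hc, hF, hFn, hX⟩ := hX
  obtain ⟨θ0, θ1, θ2, ρ, d, G, Gn, hd, hG, hGn, hY⟩ := hY
  rw [generalField_eq_ansatz] at hX hY
  have h1 := smoothData_general (n := n) τ0 τ1 τ2 σ hF hFn
  have h2 := smoothData_general (n := n) θ0 θ1 θ2 ρ hG hGn
  have s : ∀ {f : ℝ → ℝ}, ContDiffOn ℝ ∞ f (times U) → ContDiffOn ℝ ∞ (deriv f) (times U) :=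
    fun hf => contDiffOn_deriv hI hf
  refine ⟨τ0 * θ1 - θ0 * τ1, 2 * (τ0 * θ2 - θ0 * τ2), τ1 * θ2 - θ1 * τ2,
    12 / (n + 7) * (τ0 * θ2 - θ0 * τ2), d * c - c * d,
    bracketF (fun t => τ2 * t ^ 2 + τ1 * t + τ0) (fun t => 24 * τ2 / (n + 7) * t + 2 * σ) c F
      (fun t => θ2 * t ^ 2 + θ1 * t + θ0) (fun t => 24 * θ2 / (n + 7) * t + 2 * ρ) d G,
    bracketFn (fun t => τ2 * t ^ 2 + τ1 * t + τ0) (fun t => 24 * τ2 / (n + 7) * t + 2 * σ) F Fn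
      (fun t => θ2 * t ^ 2 + θ1 * t + θ0) (fun t => 24 * θ2 / (n + 7) * t + 2 * ρ) G Gn,
    ?_, ?_, ?_, ?_⟩
  case refine_4 =>
    rw [generalField_eq_ansatz]
    refine Set.EqOn.trans (fun b hb => ?_) ((lieBracket_ansatz hU h1 h2 hc hd).trans
      (ansatz_congr hU (fun t _ => ?_) (fun t _ => ?_) (fun _ _ _ => rfl) fun _ _ => rfl))
    · exact Filter.EventuallyEq.lieBracket_vectorField_eq
        (hX.eventuallyEq_of_mem (hU.mem_nhds hb)) (hY.eventuallyEq_of_mem (hU.mem_nhds hb))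
    · simp only [deriv_quad]
      ring
    · simp only [deriv_affine]
      field_simp
      ring
  · intro i j
    simp only [Matrix.sub_apply, Matrix.mul_apply, ← Finset.sum_sub_distrib,
      ← Finset.sum_neg_distrib]
    refine Finset.sum_congr rfl fun k _ => ?_
    rw [hd i k, hc k j, hc i k, hd k j]
    ring
  · intro i
    exact ((((h1.tau.mul (s (hG i))).sub (h2.tau.mul (s (hF i)))).add
      ((h2.mu.div_const 2).mul (hF i))).sub ((h1.mu.div_const 2).mul (hG i))).add
      ((ContDiffOn.sum fun j _ => contDiffOn_const.mul (hF j)).sub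
        (ContDiffOn.sum fun j _ => contDiffOn_const.mul (hG j)))
  · exact ((((h1.tau.mul (s hGn)).sub (h2.tau.mul (s hFn))).add
      ((h2.mu.sub (s h2.tau)).mul hFn)).sub ((h1.mu.sub (s h1.tau)).mul hGn)).sub
      (contDiffOn_const.mul ((ContDiffOn.sum fun j _ => (s (hG j)).mul (hF j)).sub
        (ContDiffOn.sum fun j _ => (s (hF j)).mul (hG j))))

/-! ### Uniqueness of the parameters -/

theorem exists_add_smul_mem (hU : IsOpen U) {b : J0 n} (hb : b ∈ U) (v : J0 n) :
    ∃ ε : ℝ, 0 < ε ∧ b + ε • v ∈ U ∧ b - ε • v ∈ U := by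
  have h1 : ∀ᶠ ε : ℝ in nhds 0, b + ε • v ∈ U :=
    (by fun_prop : Continuous fun ε : ℝ => b + ε • v).continuousAt.eventually_mem
      (by simpa using hU.mem_nhds hb)
  have h2 : ∀ᶠ ε : ℝ in nhds 0, b - ε • v ∈ U :=
    (by fun_prop : Continuous fun ε : ℝ => b - ε • v).continuousAt.eventually_mem
      (by simpa using hU.mem_nhds hb)
  obtain ⟨ε, h, h0⟩ := (((h1.and h2).filter_mono nhdsWithin_le_nhds).and
    (self_mem_nhdsWithin : Set.Ioi (0 : ℝ) ∈ nhdsWithin 0 (Set.Ioi 0))).exists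
  exact ⟨ε, h0, h.1, h.2⟩

/-- The parameters are determined by the field: `τ` is a polynomial on an open set of times, and
differences in the directions `∂_{y_j}` isolate the linear part of the transverse components. -/
theorem generalField_unique (hn : 2 < n) (hU : IsOpen U) (hUne : U.Nonempty)
    {τ0 τ1 τ2 σ τ0' τ1' τ2' σ' : ℝ} {c c' : Matrix (Fin (n - 1)) (Fin (n - 1)) ℝ}
    {F F' : Fin (n - 1) → ℝ → ℝ} {Fn Fn' : ℝ → ℝ} (hc : ∀ i j, c i j = -c j i)
    (hc' : ∀ i j, c' i j = -c' j i)
    (h : Set.EqOn (generalField n τ0 τ1 τ2 σ c F Fn)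
      (generalField n τ0' τ1' τ2' σ' c' F' Fn') U) :
    τ0 = τ0' ∧ τ1 = τ1' ∧ τ2 = τ2' ∧ σ = σ' ∧ c = c' ∧
      (∀ i, Set.EqOn (F i) (F' i) (times U)) ∧ Set.EqOn Fn Fn' (times U) := by
  have hI := isOpen_times hU
  have ht : ∀ b ∈ U, τ2 * b.1 (tv n) ^ 2 + τ1 * b.1 (tv n) + τ0
      = τ2' * b.1 (tv n) ^ 2 + τ1' * b.1 (tv n) + τ0' := fun b hb =>
    congrArg (fun z : J0 n => z.1 (tv n)) (h hb)
  obtain ⟨b, hb⟩ := hUne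
  obtain ⟨ε, hε, hp, hm⟩ := exists_add_smul_mem hU hb (dirI (tv n))
  have h0 := ht b hb
  have h1 := ht _ hp
  have h2 := ht _ hm
  simp [dirI] at h1 h2
  have e2 : τ2 = τ2' := by
    have : ε ^ 2 * (τ2 - τ2') = 0 := by linear_combination 1 / 2 * h1 + 1 / 2 * h2 - h0
    rcases mul_eq_zero.1 this with h3 | h3
    · exact absurd h3 (by positivity)
    · linarith
  have e1 : τ1 = τ1' := by
    subst e2
    have : ε * (τ1 - τ1') = 0 := by linear_combination h1 - h0
    rcases mul_eq_zero.1 this with h3 | h3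
    · exact absurd h3 hε.ne'
    · linarith
  have e0 : τ0 = τ0' := by
    subst e1 e2
    linarith
  subst e0 e1 e2
  have hy : ∀ b ∈ U, ∀ i : Fin (n - 1), (12 * τ2 * b.1 (tv n) / (n + 7) + σ) * b.1 (yv i)
      + ∑ j, c i j * b.1 (yv j) + F i (b.1 (tv n))
      = (12 * τ2 * b.1 (tv n) / (n + 7) + σ') * b.1 (yv i)
      + ∑ j, c' i j * b.1 (yv j) + F' i (b.1 (tv n)) := fun b hb i =>
    congrArg (fun z : J0 n => z.1 (yv i)) (h hb)
  have hlin : ∀ i j : Fin (n - 1), (if i = j then σ else 0) + c i j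
      = (if i = j then σ' else 0) + c' i j := by
    intro i j
    obtain ⟨ε, hε, hp, -⟩ := exists_add_smul_mem hU hb (dirI (yv j))
    have k0 := hy b hb i
    have k1 := hy _ hp i
    simp [dirI, Pi.single_apply, mul_add, Finset.sum_add_distrib] at k1
    have : ε * ((if i = j then σ else 0) + c i j - ((if i = j then σ' else 0) + c' i j)) = 0 := by
      split_ifs at k1 ⊢ <;> linear_combination k1 - k0
    rcases mul_eq_zero.1 this with h3 | h3
    · exact absurd h3 hε.ne'
    · linarith
  have eσ : σ = σ' := by
    let i : Fin (n - 1) := ⟨0, by omega⟩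
    have k := hlin i i
    simp only [if_true] at k
    linarith [hc i i, hc' i i]
  subst eσ
  have ec : c = c' := by
    ext i j
    linarith [hlin i j]
  subst ec
  have eF : ∀ i, Set.EqOn (F i) (F' i) (times U) := by
    rintro i _ ⟨b, hb, rfl⟩
    have := hy b hb i
    simp only
    linarith
  refine ⟨rfl, rfl, rfl, rfl, rfl, eF, ?_⟩
  rintro _ ⟨b, hb, rfl⟩
  have hx := congrArg (fun z : J0 n => z.1 (xv n)) (h hb)
  simp only [generalField, vec] at hx
  simp only [fun i => eqOn_deriv hI (eF i) (mem_times hb)] at hx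
  simpa using hx

/-! ### Generators -/

/-- The general field depends linearly on its parameters. -/
theorem generalField_add_smul (hU : IsOpen U) (k : ℝ)
    {τ0 τ1 τ2 σ τ0' τ1' τ2' σ' : ℝ} {c c' : Matrix (Fin (n - 1)) (Fin (n - 1)) ℝ}
    {F F' : Fin (n - 1) → ℝ → ℝ} {Fn Fn' : ℝ → ℝ}
    (hF : ∀ i, ContDiffOn ℝ ∞ (F i) (times U)) (hF' : ∀ i, ContDiffOn ℝ ∞ (F' i) (times U))
    (hFn : ContDiffOn ℝ ∞ Fn (times U)) (hFn' : ContDiffOn ℝ ∞ Fn' (times U)) :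
    Set.EqOn (generalField n τ0 τ1 τ2 σ c F Fn + k • generalField n τ0' τ1' τ2' σ' c' F' Fn')
      (generalField n (τ0 + k * τ0') (τ1 + k * τ1') (τ2 + k * τ2') (σ + k * σ') (c + k • c')
        (fun i t => F i t + k * F' i t) fun t => Fn t + k * Fn' t) U := by
  intro b hb
  have hI := isOpen_times hU
  have ht := mem_times hb
  have d : ∀ {f g : ℝ → ℝ}, ContDiffOn ℝ ∞ f (times U) → ContDiffOn ℝ ∞ g (times U) →
      Set.EqOn (deriv fun t => f t + k * g t) (fun t => deriv f t + k * deriv g t) (times U) :=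
    fun hf hg t ht => ((hasDerivAt_of_smooth hI hf ht).add
      ((hasDerivAt_of_smooth hI hg ht).const_mul k)).deriv
  have s : ∀ {f : ℝ → ℝ}, ContDiffOn ℝ ∞ f (times U) → ContDiffOn ℝ ∞ (deriv f) (times U) :=
    fun hf => contDiffOn_deriv hI hf
  have e1 := fun i => d (hF i) (hF' i) ht
  have e2 := fun i => (eqOn_deriv hI (d (hF i) (hF' i)) ht).trans (d (s (hF i)) (s (hF' i)) ht)
  have e3 := d hFn hFn' ht
  simp only at e1 e2 e3
  simp only [Pi.add_apply, Pi.smul_apply, generalField, e1, e2, e3, Matrix.add_apply,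
    Matrix.smul_apply, smul_eq_mul, add_mul, Finset.sum_add_distrib, mul_assoc k,
    ← Finset.mul_sum]
  refine Prod.ext (funext fun l => ?_) ?_
  · rcases l with l | i
    · fin_cases l
      · simp [vec]; ring
      · simp [vec]; ring
    · simp [vec]; ring
  · simp [vec]; ring

theorem IsLieSymmetry.add_smul (hn : 2 < n) (hU : IsOpen U) (hUc : Convex ℝ U)
    (hUne : U.Nonempty) {X Y : J0 n → J0 n} (hX : IsLieSymmetry n U X)
    (hY : IsLieSymmetry n U Y) (k : ℝ) : IsLieSymmetry n U (X + k • Y) := by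
  rw [isLieSymmetry_iff hn hU hUc hUne] at hX hY ⊢
  obtain ⟨τ0, τ1, τ2, σ, c, F, Fn, hc, hF, hFn, hX⟩ := hX
  obtain ⟨θ0, θ1, θ2, ρ, d, G, Gn, hd, hG, hGn, hY⟩ := hY
  refine ⟨τ0 + k * θ0, τ1 + k * θ1, τ2 + k * θ2, σ + k * ρ, c + k • d,
    fun i t => F i t + k * G i t, fun t => Fn t + k * Gn t, fun i j => ?_,
    fun i => (hF i).add (contDiffOn_const.mul (hG i)), hFn.add (contDiffOn_const.mul hGn),
    fun b hb => ?_⟩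
  · simp only [Matrix.add_apply, Matrix.smul_apply, smul_eq_mul]
    rw [hc i j, hd i j]
    ring
  · rw [← generalField_add_smul hU k hF hG hFn hGn hb]
    simp [hX hb, hY hb]

theorem fieldT_eq : fieldT n = generalField n 1 0 0 0 0 (fun _ _ => 0) fun _ => 0 := by
  funext b
  simp [fieldT, generalField, Pi.zero_def]

theorem fieldDtilde_eq : fieldDtilde n = generalField n 0 1 0 0 0 (fun _ _ => 0) fun _ => 0 := by
  have hn7 : ((n : ℝ) + 7) ≠ 0 := by positivity
  funext b
  simp [fieldDtilde, generalField, Pi.zero_def]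
  congr 1
  field_simp

theorem fieldC_eq : fieldC n = generalField n 0 0 1 0 0 (fun _ _ => 0) fun _ => 0 := by
  funext b
  simp [fieldC, generalField]
  congr 1
  ring

theorem fieldD0_eq : fieldD0 n = generalField n 0 0 0 1 0 (fun _ _ => 0) fun _ => 0 := by
  have hn7 : ((n : ℝ) + 7) ≠ 0 := by positivity
  funext b
  simp [fieldD0, generalField]
  congr 1
  field_simp

theorem fieldR_eq (i j : Fin (n - 1)) : fieldR n i j = generalField n 0 0 0 0
    (Matrix.single j i 1 - Matrix.single i j 1) (fun _ _ => 0) fun _ => 0 := by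
  funext b
  simp [fieldR, generalField]
  congr 1
  funext k
  simp [Matrix.single_apply, sub_mul, Finset.sum_sub_distrib, Pi.single_apply, ite_and, eq_comm]

theorem fieldX_eq (f : ℝ → ℝ) : fieldX n f = generalField n 0 0 0 0 0 (fun _ _ => 0) f := by
  funext b
  simp [fieldX, generalField, Pi.zero_def]

theorem deriv_ite_const (p : Prop) [Decidable p] (f : ℝ → ℝ) :
    deriv (fun t => if p then f t else 0) = fun t => if p then deriv f t else 0 := by
  split_ifs <;> simp

theorem fieldY_eq (i : Fin (n - 1)) (f : ℝ → ℝ) : fieldY n i f = generalField n 0 0 0 0 0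
    (fun j t => if j = i then f t else 0) fun _ => 0 := by
  funext b
  simp only [fieldY, generalField, deriv_ite_const]
  simp
  congr 1
  · ring
  · funext k
    simp [Pi.single_apply]
  · ring

theorem IsLieSymmetry.of_generators (hn : 2 < n) (hU : IsOpen U) (hUc : Convex ℝ U)
    (hUne : U.Nonempty) {Z : J0 n → J0 n} (hZ : Z ∈ generators n (times U)) :
    IsLieSymmetry n U Z := by
  have mk : ∀ {τ0 τ1 τ2 σ : ℝ} {c : Matrix (Fin (n - 1)) (Fin (n - 1)) ℝ}
      {F : Fin (n - 1) → ℝ → ℝ} {Fn : ℝ → ℝ}, Z = generalField n τ0 τ1 τ2 σ c F Fn →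
      (∀ i j, c i j = -c j i) → (∀ i, ContDiffOn ℝ ∞ (F i) (times U)) →
      ContDiffOn ℝ ∞ Fn (times U) → IsLieSymmetry n U Z := fun hZ hc hF hFn =>
    (isLieSymmetry_iff hn hU hUc hUne _).2 ⟨_, _, _, _, _, _, _, hc, hF, hFn, fun b _ => by rw [hZ]⟩
  have z : ∀ i j, (0 : Matrix (Fin (n - 1)) (Fin (n - 1)) ℝ) i j
      = -(0 : Matrix (Fin (n - 1)) (Fin (n - 1)) ℝ) j i := fun _ _ => by simp
  have s0 : ContDiffOn ℝ ∞ (fun _ : ℝ => (0 : ℝ)) (times U) := contDiffOn_const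
  rcases hZ with ((h | ⟨i, j, -, rfl⟩) | ⟨f, hf, rfl⟩) | ⟨i, f, hf, rfl⟩
  · rcases h with rfl | rfl | rfl | rfl
    · exact mk fieldT_eq z (fun _ => s0) s0
    · exact mk fieldDtilde_eq z (fun _ => s0) s0
    · exact mk fieldC_eq z (fun _ => s0) s0
    · exact mk fieldD0_eq z (fun _ => s0) s0
  · refine mk (fieldR_eq i j) (fun k l => ?_) (fun _ => s0) s0
    simp only [Matrix.sub_apply, Matrix.single_apply, and_comm]
    ring
  · exact mk (fieldX_eq f) z (fun _ => s0) hf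
  · refine mk (fieldY_eq i f) z (fun j => ?_) s0
    split_ifs
    exacts [hf, s0]

theorem fieldR_mem_span (I : Set ℝ) (i j : Fin (n - 1)) :
    fieldR n i j ∈ Submodule.span ℝ (generators n I) := by
  rcases lt_trichotomy i j with h | rfl | h
  · exact Submodule.subset_span (Or.inl (Or.inl (Or.inr ⟨i, j, h, rfl⟩)))
  · have : fieldR n i i = 0 := by
      funext b
      refine Prod.ext (funext fun k => ?_) rfl
      rcases k with k | k
      · fin_cases k <;> rfl
      · simp [fieldR, vec]
    rw [this]
    exact Submodule.zero_mem _
  · have : fieldR n i j = -fieldR n j i := by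
      funext b
      refine Prod.ext (funext fun k => ?_) (by simp [fieldR, vec])
      rcases k with k | k
      · fin_cases k <;> simp [fieldR, vec]
      · simp [fieldR, vec]
    rw [this]
    exact Submodule.neg_mem _ (Submodule.subset_span (Or.inl (Or.inl (Or.inr ⟨j, i, h, rfl⟩))))

/-- The expansion of the general field in the generators. The sum over all pairs `(i, j)` counts
each rotation twice, whence the factor `1 / 2`. -/
theorem generalField_eq_sum (τ0 τ1 τ2 σ : ℝ) {c : Matrix (Fin (n - 1)) (Fin (n - 1)) ℝ}
    (hc : ∀ i j, c i j = -c j i) (F : Fin (n - 1) → ℝ → ℝ) (Fn : ℝ → ℝ) :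
    generalField n τ0 τ1 τ2 σ c F Fn = τ0 • fieldT n + τ1 • fieldDtilde n + τ2 • fieldC n
      + σ • fieldD0 n + ∑ i, ∑ j, (-(c i j) / 2) • fieldR n i j + fieldX n Fn
      + ∑ i, fieldY n i (F i) := by
  have hn7 : ((n : ℝ) + 7) ≠ 0 := by positivity
  funext b
  refine Prod.ext (funext fun l => ?_) ?_
  · rcases l with l | k
    · fin_cases l
      · simp [generalField, vec, fieldT, fieldDtilde, fieldC, fieldD0, fieldR, fieldX, fieldY,
          Finset.sum_apply, Prod.fst_sum]
        ring
      · simp [generalField, vec, fieldT, fieldDtilde, fieldC, fieldD0, fieldR, fieldX, fieldY,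
          Finset.sum_apply, Prod.fst_sum, Finset.mul_sum]
        ring_nf
    · have e : ∑ j, -c j k / 2 * b.1 (yv j) - ∑ j, -c k j / 2 * b.1 (yv j)
          = ∑ j, c k j * b.1 (yv j) := by
        rw [← Finset.sum_sub_distrib]
        exact Finset.sum_congr rfl fun j _ => by rw [hc j k]; ring
      simp [generalField, vec, fieldT, fieldDtilde, fieldC, fieldD0, fieldR, fieldX, fieldY,
          Finset.sum_apply, Prod.fst_sum, Pi.single_apply, mul_sub, Finset.sum_sub_distrib, e]
      ring
  · have e : ∑ i : Fin (n - 1), 2⁻¹ * deriv (deriv (F i)) (b.1 (tv n)) * b.1 (yv i)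
        = 2⁻¹ * ∑ i : Fin (n - 1), deriv (deriv (F i)) (b.1 (tv n)) * b.1 (yv i) := by
      simp only [Finset.mul_sum, mul_assoc]
    simp [generalField, vec, fieldT, fieldDtilde, fieldC, fieldD0, fieldR, fieldX, fieldY,
      Finset.sum_apply, Prod.snd_sum, e]
    field_simp
    ring

theorem generalField_mem_span {I : Set ℝ} (τ0 τ1 τ2 σ : ℝ)
    {c : Matrix (Fin (n - 1)) (Fin (n - 1)) ℝ} (hc : ∀ i j, c i j = -c j i)
    {F : Fin (n - 1) → ℝ → ℝ} {Fn : ℝ → ℝ} (hF : ∀ i, ContDiffOn ℝ ∞ (F i) I)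
    (hFn : ContDiffOn ℝ ∞ Fn I) :
    generalField n τ0 τ1 τ2 σ c F Fn ∈ Submodule.span ℝ (generators n I) := by
  rw [generalField_eq_sum τ0 τ1 τ2 σ hc]
  have g : ∀ {Z}, Z ∈ ({fieldT n, fieldDtilde n, fieldC n, fieldD0 n} : Set (J0 n → J0 n)) →
      Z ∈ Submodule.span ℝ (generators n I) := fun h =>
    Submodule.subset_span (Or.inl (Or.inl (Or.inl h)))
  refine add_mem (add_mem (add_mem (add_mem (add_mem (add_mem ?_ ?_) ?_) ?_) ?_) ?_) ?_
  · exact Submodule.smul_mem _ _ (g (by simp))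
  · exact Submodule.smul_mem _ _ (g (by simp))
  · exact Submodule.smul_mem _ _ (g (by simp))
  · exact Submodule.smul_mem _ _ (g (by simp))
  · exact sum_mem fun i _ => sum_mem fun j _ => Submodule.smul_mem _ _ (fieldR_mem_span I i j)
  · exact Submodule.subset_span (Or.inl (Or.inr ⟨Fn, hFn, rfl⟩))
  · exact sum_mem fun i _ => Submodule.subset_span (Or.inr ⟨i, F i, hF i, rfl⟩)

theorem isLieSymmetry_iff_span (hn : 2 < n) (hU : IsOpen U) (hUc : Convex ℝ U)
    (hUne : U.Nonempty) (X : J0 n → J0 n) : IsLieSymmetry n U X ↔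
      ∃ Z ∈ Submodule.span ℝ (generators n (times U)), Set.EqOn X Z U := by
  constructor
  · intro hX
    obtain ⟨τ0, τ1, τ2, σ, c, F, Fn, hc, hF, hFn, hX⟩ :=
      (isLieSymmetry_iff hn hU hUc hUne X).1 hX
    exact ⟨_, generalField_mem_span τ0 τ1 τ2 σ hc hF hFn, hX⟩
  · rintro ⟨Z, hZ, hXZ⟩
    refine IsLieSymmetry.congr hU ?_ hXZ
    clear hXZ
    have hT : IsLieSymmetry n U (fieldT n) :=
      IsLieSymmetry.of_generators hn hU hUc hUne (Or.inl (Or.inl (Or.inl (by simp))))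
    have h0 : IsLieSymmetry n U 0 := by
      simpa using hT.add_smul hn hU hUc hUne hT (-1)
    induction hZ using Submodule.span_induction with
    | mem Z hZ => exact IsLieSymmetry.of_generators hn hU hUc hUne hZ
    | zero => exact h0
    | add Y Z _ _ hY hZ => simpa using hY.add_smul hn hU hUc hUne hZ 1
    | smul k Z _ hZ => simpa using h0.add_smul hn hU hUc hUne hZ k

end

end DKP

theorem mainTheorem1 (n : ℕ) (hn : 2 < n) (U : Set (DKP.J0 n)) (hUo : IsOpen U)
    (hUc : Convex ℝ U) (hUne : U.Nonempty) :
    -- the symmetries are exactly the fields of the stated form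
    (∀ X : DKP.J0 n → DKP.J0 n, DKP.IsLieSymmetry n U X ↔
      ∃ (τ0 τ1 τ2 σ : ℝ) (c : Matrix (Fin (n - 1)) (Fin (n - 1)) ℝ)
        (F : Fin (n - 1) → ℝ → ℝ) (Fn : ℝ → ℝ),
        (∀ i j, c i j = -c j i) ∧
        (∀ i, ContDiffOn ℝ ∞ (F i) (DKP.times U)) ∧
        ContDiffOn ℝ ∞ Fn (DKP.times U) ∧
        Set.EqOn X (DKP.generalField n τ0 τ1 τ2 σ c F Fn) U) ∧
    -- the constants and the functions of time are determined by the field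
    (∀ (τ0 τ1 τ2 σ τ0' τ1' τ2' σ' : ℝ) (c c' : Matrix (Fin (n - 1)) (Fin (n - 1)) ℝ)
        (F F' : Fin (n - 1) → ℝ → ℝ) (Fn Fn' : ℝ → ℝ),
        (∀ i j, c i j = -c j i) → (∀ i j, c' i j = -c' j i) →
        (∀ i, ContDiffOn ℝ ∞ (F i) (DKP.times U)) →
        (∀ i, ContDiffOn ℝ ∞ (F' i) (DKP.times U)) →
        ContDiffOn ℝ ∞ Fn (DKP.times U) → ContDiffOn ℝ ∞ Fn' (DKP.times U) →
        Set.EqOn (DKP.generalField n τ0 τ1 τ2 σ c F Fn)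
          (DKP.generalField n τ0' τ1' τ2' σ' c' F' Fn') U →
        τ0 = τ0' ∧ τ1 = τ1' ∧ τ2 = τ2' ∧ σ = σ' ∧ c = c' ∧
          (∀ i, Set.EqOn (F i) (F' i) (DKP.times U)) ∧ Set.EqOn Fn Fn' (DKP.times U)) ∧
    -- the symmetries are the span of the listed generators
    (∀ X : DKP.J0 n → DKP.J0 n, DKP.IsLieSymmetry n U X ↔
      ∃ Z ∈ Submodule.span ℝ (DKP.generators n (DKP.times U)), Set.EqOn X Z U) ∧
    -- the symmetries are closed under the Lie bracket of vector fields
    (∀ X Y : DKP.J0 n → DKP.J0 n, DKP.IsLieSymmetry n U X → DKP.IsLieSymmetry n U Y →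
      DKP.IsLieSymmetry n U (VectorField.lieBracket ℝ X Y)) := by
  exact ⟨DKP.isLieSymmetry_iff hn hUo hUc hUne,
    fun _ _ _ _ _ _ _ _ _ _ _ _ _ _ hc hc' _ _ _ _ h =>
      DKP.generalField_unique hn hUo hUne hc hc' h,
    DKP.isLieSymmetry_iff_span hn hUo hUc hUne,
    fun _ _ hX hY => hX.lieBracket hn hUo hUc hUne hY⟩
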